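/- Let $A_i=\begin{pmatrix}a_i&b_i\\c_i&d_i\end{pmatrix}\in\mathbb R^{2\times2}$ with $\det A_i=1$ and $b_i>0$ ($i=1,2$), let $\tau,\sigma>0$, and write $\boldsymbol\tau=[-\tau,\tau]^2$, $\boldsymbol\sigma=[-\sigma,\sigma]^2$, with indicator functions $p_{\boldsymbol\tau},p_{\boldsymbol\sigma}$. Let $\mathbb H$ be the quaternions and $\|f\|^2=\int_{\mathbb R^2}|f|^2$ for $f\in L^2(\mathbb R^2;\mathbb H)$. The two-sided quaternionic linear canonical transform (QLCT) of $f\in L^1\cap L^2(\mathbb R^2;\mathbb H)$ is $$\mathcal L(f)(u,v)=\int_{\mathbb R^2}K^{\mathbf i}_{A_1}(x,u)\,f(x,y)\,K^{\mathbf j}_{A_2}(y,v)\,dx\,dy,\qquad K^{\mathbf e}_{A}(x,u)=\tfrac1{\sqrt{2\pi b\,\mathbf e}}\,e^{\mathbf e\left(\frac{a}{2b}x^2-\frac1b xu+\frac{d}{2b}u^2\right)},$$ and $\mathcal L$ is extended to $L^2(\mathbb R^2;\mathbb H)$ by limits in mean of the transforms of the truncations $f\cdot 1_{[-R,R]^2}$,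 $R\to\infty$. For $f\in L^2(\mathbb R^2;\mathbb H)$, $f\ne0$, put $$\alpha_f=\frac{\|p_{\boldsymbol\tau}f\|^2}{\|f\|^2},\qquad \beta_f=\frac{\|p_{\boldsymbol\sigma}\mathcal L(f)\|^2}{\|\mathcal L(f)\|^2},\qquad \tilde f(x,y)=e^{\mathbf i\frac{a_1}{2b_1}x^2}f(x,y)\,e^{\mathbf j\frac{a_2}{2b_2}y^2}.$$ Consider the low-pass integral equation, for nonzero $\tilde\psi\in L^2(\mathbb R^2;\mathbb H)$ and $\mu\in\mathbb R$, $$\mu\,\tilde\psi(u,v)=\int_{\boldsymbol\tau}\tilde\psi(x,y)\,\frac{\sin\frac{\sigma}{b_1}(x-u)}{\pi(x-u)}\,\frac{\sin\frac{\sigma}{b_2}(y-v)}{\pi(y-v)}\,dx\,dy\qquad\text{for all }(u,v)\in\mathbb R^2.$$ Theorem. The eigenvalues $\mu$ of this equation have a largest element $\mu_0$, and $0<\mu_0<1$. For every $\alpha$ with $\mu_0<\alpha\le1$, the maximum $\beta_{\max}$ of $\beta_f$ over all nonzero $f\in L^2(\mathbb R^2;\mathbb H)$ with $\alpha_f=\alpha$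 exists and satisfies $$\arccos\sqrt{\beta_{\max}}+\arccos\sqrt{\alpha}=\arccos\sqrt{\mu_0}.$$ Moreover, $f\in L^2(\mathbb R^2;\mathbb H)$ satisfies $\|f\|=1$, $\alpha_f=\alpha$ and $\beta_f=\beta_{\max}$ if and only if $$\tilde f=\sqrt{\frac{1-\alpha}{1-\mu_0}}\;\tilde\psi_0+\left(\sqrt{\frac{\alpha}{\mu_0}}-\sqrt{\frac{1-\alpha}{1-\mu_0}}\right)p_{\boldsymbol\tau}\,\tilde\psi_0\quad\text{almost everywhere}$$ for some solution $\tilde\psi_0$ of the low-pass integral equation with $\mu=\mu_0$ and $\|\tilde\psi_0\|=1$. -/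

import Mathlib

open MeasureTheory Filter Topology

noncomputable section

namespace QLCT

/-- The copy `{a + b i}` of the complex numbers in the quaternions. -/
def complexI (z : ℂ) : Quaternion ℝ := ⟨z.re, z.im, 0, 0⟩

/-- The copy `{a + b j}` of the complex numbers in the quaternions. -/
def complexJ (z : ℂ) : Quaternion ℝ := ⟨z.re, 0, z.im, 0⟩

/-- The scalar linear canonical kernel
`(1 / √(2 π b I)) exp (I (a x² / (2 b) - x u / b + d u² / (2 b)))` of the matrix
`A = (a b; c d)` with `b ≠ 0`; the square root is the principal one. -/
def lctKernel (A : Matrix (Fin 2) (Fin 2) ℝ) (x u : ℝ) : ℂ :=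
  1 / (Complex.I * (2 * Real.pi * A 0 1 : ℝ)) ^ (1 / 2 : ℂ) *
    Complex.exp (Complex.I *
      (A 0 0 / (2 * A 0 1) * x ^ 2 - 1 / A 0 1 * (x * u) + A 1 1 / (2 * A 0 1) * u ^ 2 : ℝ))

/-- The square `[-r, r] × [-r, r]`. -/
def square (r : ℝ) : Set (ℝ × ℝ) := Set.Icc (-r) r ×ˢ Set.Icc (-r) r

/-- The integral defining the two-sided quaternionic linear canonical transform of an integrable
signal: the `i`-kernel acts from the left, the `j`-kernel from the right. -/
def qlctIntegral (A₁ A₂ : Matrix (Fin 2) (Fin 2) ℝ) (f : ℝ × ℝ → Quaternion ℝ) (w : ℝ × ℝ) :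
    Quaternion ℝ :=
  ∫ z : ℝ × ℝ, complexI (lctKernel A₁ z.1 w.1) * f z * complexJ (lctKernel A₂ z.2 w.2)

/-- `F` is a quaternionic linear canonical transform of the square-integrable signal `f`:
it is the limit in mean of the transforms of the truncations of `f` (these are integrable).
Such an `F` exists by Parseval's identity, is unique up to null sets, and agrees almost everywhere
with `qlctIntegral A₁ A₂ f` if `f` is also integrable. -/
def IsQLCT (A₁ A₂ : Matrix (Fin 2) (Fin 2) ℝ) (f F : ℝ × ℝ → Quaternion ℝ) : Prop :=
  MemLp F 2 volume ∧
    Tendsto (fun R : ℝ => eLpNorm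
      (fun w => F w - qlctIntegral A₁ A₂ ((square R).indicator f) w) 2 volume) atTop (𝓝 0)

open Classical in
/-- The quaternionic linear canonical transform on square-integrable signals (a representative,
determined up to null sets). -/
def qlct (A₁ A₂ : Matrix (Fin 2) (Fin 2) ℝ) (f : ℝ × ℝ → Quaternion ℝ) :
    ℝ × ℝ → Quaternion ℝ :=
  if h : ∃ F, IsQLCT A₁ A₂ f F then h.choose else 0

/-- The energy `‖f‖²` of a signal. -/
def energy (f : ℝ × ℝ → Quaternion ℝ) : ℝ := ∫ z, ‖f z‖ ^ 2

/-- The spatial energy ratio `‖p_τ f‖² / ‖f‖²`. -/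
def spatialRatio (τ : ℝ) (f : ℝ × ℝ → Quaternion ℝ) : ℝ :=
  energy ((square τ).indicator f) / energy f

/-- The frequency energy ratio `‖p_σ L(f)‖² / ‖L(f)‖²`. -/
def frequencyRatio (A₁ A₂ : Matrix (Fin 2) (Fin 2) ℝ) (σ : ℝ) (f : ℝ × ℝ → Quaternion ℝ) : ℝ :=
  energy ((square σ).indicator (qlct A₁ A₂ f)) / energy (qlct A₁ A₂ f)

/-- The signal `f` multiplied by the two chirps,
`exp (i a₁ x² / (2 b₁)) f(x, y) exp (j a₂ y² / (2 b₂))`. -/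
def chirped (A₁ A₂ : Matrix (Fin 2) (Fin 2) ℝ) (f : ℝ × ℝ → Quaternion ℝ) (z : ℝ × ℝ) :
    Quaternion ℝ :=
  complexI (Complex.exp (Complex.I * (A₁ 0 0 / (2 * A₁ 0 1) * z.1 ^ 2 : ℝ))) * f z *
    complexJ (Complex.exp (Complex.I * (A₂ 0 0 / (2 * A₂ 0 1) * z.2 ^ 2 : ℝ)))

/-- The low-pass kernel `sin (ω t) / (π t)`, with the value `ω / π` at `t = 0`. -/
def lowPassKernel (ω t : ℝ) : ℝ := ω / Real.pi * Real.sinc (ω * t)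

/-- `ψ` is a square-integrable solution, not almost everywhere zero, of the low-pass integral
equation on the square `[-τ, τ]²` with bandwidths `ω₁`, `ω₂` and eigenvalue `μ`. -/
def IsLowPassEigenfunction (τ ω₁ ω₂ μ : ℝ) (ψ : ℝ × ℝ → Quaternion ℝ) : Prop :=
  MemLp ψ 2 volume ∧ ¬ ψ =ᵐ[volume] 0 ∧
    ∀ w : ℝ × ℝ, μ • ψ w = ∫ z in square τ,
      (lowPassKernel ω₁ (z.1 - w.1) * lowPassKernel ω₂ (z.2 - w.2)) • ψ z

/-- The set of eigenvalues of the low-pass integral equation. -/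
def lowPassEigenvalues (τ ω₁ ω₂ : ℝ) : Set ℝ :=
  {μ | ∃ ψ, IsLowPassEigenfunction τ ω₁ ω₂ μ ψ}

end QLCT

end

/-! Multiplication by the two chirps is unitary, and it turns the canonical transform into the
two-sided quaternionic Fourier transform, up to a dilation of the frequencies and outer factors of
constant modulus that cancel its Jacobian (`qlct_ae_eq`, `eLpNorm_outer`). For x the class of the
chirped signal, the two ratios become ‖Dx‖²/‖x‖² and ‖Bx‖²/‖x‖², where D is the cutoff to the square
and B the projection onto the frequencies in a rectangle (`spatialRatio_eq`, `frequencyRatio_eq`).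
The product BD is the integral operator of the low-pass equation (`bandLimit_cutoff_ae`).

What remains is geometry of two projections, with μ₀ = ‖BD‖². Let x be a unit vector with ‖Dx‖² = α,
let g be a unit vector in the range of B, and put t = ‖Dg‖ ≤ √μ₀ < √α. Splitting along D and its
complement, ⟪x, g⟫ ≤ √α t + √(1-α) √(1-t²) = cos(arccos t - arccos √α), which is largest exactly at
t = √μ₀. Since ‖Bx‖ = ⟪x, Bx/‖Bx‖⟫ when Bx ≠ 0, this is the sharp bound (`norm_sq_le_cosGap_sq`).
Equality forces BDg = μ₀g and both Cauchy–Schwarz inequalities to be tight, hence the formula for x;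
conversely every such x is extremal (`extremal_of_eigen`).

The norm of BD is attained because time limiting followed by band limiting is compact
(`tendsto_limitedFourier_of_weak`, `exists_norm_eq_opNorm`), and a maximizer yields an eigenvector
for μ₀. Both 0 < μ₀ and μ₀ < 1 rest on analyticity: the transform of a nonzero signal of bounded
support cannot vanish on a nonempty open set (`eq_zero_of_qft_eq_zero`). Statements on the
quaternionic transform reduce to complex ones by splitting the quaternions into the two lines i q j
= ± q, on which right multiplication by j is left multiplication by ∓i. -/

noncomputable section

namespace QLCT

/-! ### Pairs of orthogonal projections -/

section Projections

open scoped RealInnerProductSpace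

/-- An idempotent symmetric operator, that is, an orthogonal projection. -/
structure IsOrthProj {H : Type*} [NormedAddCommGroup H] [InnerProductSpace ℝ H]
    (D : H →L[ℝ] H) : Prop where
  idem : ∀ x, D (D x) = D x
  symm : ∀ x y, ⟪D x, y⟫ = ⟪x, D y⟫

variable {H : Type*} [NormedAddCommGroup H] [InnerProductSpace ℝ H] {D B : H →L[ℝ] H}

namespace IsOrthProj

theorem inner_self (hD : IsOrthProj D) (x : H) : ⟪D x, x⟫ = ‖D x‖ ^ 2 := by
  rw [← real_inner_self_eq_norm_sq, hD.symm x (D x), hD.idem, hD.symm]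

theorem norm_sub_sq (hD : IsOrthProj D) (x : H) : ‖x - D x‖ ^ 2 = ‖x‖ ^ 2 - ‖D x‖ ^ 2 := by
  rw [norm_sub_sq_real, real_inner_comm, hD.inner_self]; ring

theorem inner_eq_add (hD : IsOrthProj D) (x y : H) :
    ⟪x, y⟫ = ⟪D x, D y⟫ + ⟪x - D x, y - D y⟫ := by
  have h1 : ⟪x, D y⟫ = ⟪D x, D y⟫ := by rw [← hD.symm x, hD.symm x (D y), hD.idem, hD.symm]
  have h2 : ⟪D x, y⟫ = ⟪D x, D y⟫ := by rw [← hD.symm (D x), hD.idem]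
  rw [inner_sub_left, inner_sub_right, inner_sub_right, h1, h2]; ring

theorem norm_apply_le (hD : IsOrthProj D) (x : H) : ‖D x‖ ≤ ‖x‖ := by
  have := hD.norm_sub_sq x
  nlinarith [sq_nonneg ‖x - D x‖, norm_nonneg x, norm_nonneg (D x)]

/-- This is ‖DB‖ = ‖BD‖ in concrete form: ‖Dg‖² = ⟪BDg, g⟫ ≤ ‖BDg‖ ‖g‖, and the hypothesis at Dg
bounds ‖BDg‖² by μ‖Dg‖², after which a factor ‖Dg‖² cancels. -/
theorem norm_sq_le_of_apply_eq (hD : IsOrthProj D) (hB : IsOrthProj B) {μ : ℝ}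
    (hμ : ∀ x, ‖B (D x)‖ ^ 2 ≤ μ * ‖x‖ ^ 2) {g : H} (hg : B g = g) :
    ‖D g‖ ^ 2 ≤ μ * ‖g‖ ^ 2 := by
  have h1 : ‖D g‖ ^ 2 = ⟪B (D g), g⟫ := by rw [hB.symm, hg, hD.inner_self]
  have h2 := real_inner_le_norm (B (D g)) g
  have h3 := hμ (D g)
  rw [hD.idem] at h3
  rcases (norm_nonneg (D g)).eq_or_lt with h0 | h0
  · have h4 := (sq_nonneg _).trans (hμ g)
    rwa [← h0, zero_pow two_ne_zero]
  · have h4 : (‖D g‖ ^ 2) ^ 2 ≤ (μ * ‖g‖ ^ 2) * ‖D g‖ ^ 2 := by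
      calc (‖D g‖ ^ 2) ^ 2 ≤ (‖B (D g)‖ * ‖g‖) ^ 2 := by
            apply pow_le_pow_left₀ (by positivity); rw [h1]; exact h2
        _ = ‖B (D g)‖ ^ 2 * ‖g‖ ^ 2 := by ring
        _ ≤ (μ * ‖D g‖ ^ 2) * ‖g‖ ^ 2 := by gcongr
        _ = _ := by ring
    nlinarith [pow_pos h0 2]

/-- Expanding, ‖BDg - μg‖² = ‖BDg‖² - 2μ‖Dg‖² + μ²‖g‖², and the bound at Dg makes the right side at
most 0. -/
theorem apply_eq_smul_of_norm_sq_eq (hD : IsOrthProj D) (hB : IsOrthProj B) {μ : ℝ}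
    (hμ : ∀ x, ‖B (D x)‖ ^ 2 ≤ μ * ‖x‖ ^ 2) {g : H} (hg : B g = g)
    (h : ‖D g‖ ^ 2 = μ * ‖g‖ ^ 2) : B (D g) = μ • g := by
  have h1 : ‖D g‖ ^ 2 = ⟪B (D g), g⟫ := by rw [hB.symm, hg, hD.inner_self]
  have h3 := hμ (D g)
  rw [hD.idem] at h3
  have h4 : ‖B (D g) - μ • g‖ ^ 2 ≤ 0 := by
    rw [norm_sub_sq_real, inner_smul_right, ← h1, norm_smul, mul_pow, Real.norm_eq_abs, sq_abs]
    rw [h] at h3 ⊢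
    nlinarith
  have h5 : ‖B (D g) - μ • g‖ = 0 := by
    nlinarith [norm_nonneg (B (D g) - μ • g), sq_nonneg ‖B (D g) - μ • g‖]
  exact sub_eq_zero.1 (norm_eq_zero.1 h5)

theorem apply_eq_self_of_eigen (hB : IsOrthProj B) {μ : ℝ} (h0 : 0 < μ)
    {g : H} (hg : B (D g) = μ • g) : B g = g := by
  have : B (μ • g) = μ • g := by rw [← hg, hB.idem]
  rw [map_smul] at this
  exact smul_right_injective H h0.ne' this

theorem norm_sq_of_eigen (hD : IsOrthProj D) (hB : IsOrthProj B) {μ : ℝ} (h0 : 0 < μ)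
    {g : H} (hg : B (D g) = μ • g) : ‖D g‖ ^ 2 = μ * ‖g‖ ^ 2 := by
  have hgg := hB.apply_eq_self_of_eigen h0 hg
  rw [← hD.inner_self]
  calc ⟪D g, g⟫ = ⟪D g, B g⟫ := by rw [hgg]
    _ = μ * ‖g‖ ^ 2 := by
      rw [← hB.symm, hg, inner_smul_left, real_inner_self_eq_norm_sq]; rfl

/-- A real eigenvalue of the product of two projections is at most the squared norm of the
product. -/
theorem eigenvalue_le (hD : IsOrthProj D) (hB : IsOrthProj B) {μ ν : ℝ} (h0 : 0 < μ)
    (hμ : ∀ x, ‖B (D x)‖ ^ 2 ≤ μ * ‖x‖ ^ 2) {x : H} (hx : x ≠ 0) (h : B (D x) = ν • x) :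
    ν ≤ μ := by
  -- An eigenvector for a positive eigenvalue lies in the range of B and satisfies ‖Dx‖² = ν‖x‖²;
  -- nonpositive eigenvalues need no argument.
  rcases le_or_gt ν 0 with hν | hν
  · exact hν.trans h0.le
  have h1 := hD.norm_sq_of_eigen hB hν h
  have h2 := hD.norm_sq_le_of_apply_eq hB hμ (hB.apply_eq_self_of_eigen hν h)
  rw [h1] at h2
  exact le_of_mul_le_mul_right h2 (by positivity)

end IsOrthProj

/-- The cosine of the difference of the angles with squared cosines `μ` and `α`. -/
def cosGap (μ α : ℝ) : ℝ := √α * √μ + √(1 - α) * √(1 - μ)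

theorem cosGap_pos {μ α : ℝ} (h0 : 0 < μ) (h : μ < α) : 0 < cosGap μ α := by
  have h2 : 0 < √μ := Real.sqrt_pos.2 h0
  have h3 : 0 < √α := Real.sqrt_pos.2 (h0.trans h)
  unfold cosGap
  positivity

/-- By the subtraction formula `cosGap μ α` is the cosine of arccos √μ - arccos √α; as μ < α, this
difference lies in [0, π], where arccos inverts cos. -/
theorem arccos_cosGap {μ α : ℝ} (h0 : 0 < μ) (h : μ < α) (h1 : α ≤ 1) :
    Real.arccos (√(cosGap μ α ^ 2)) + Real.arccos √α = Real.arccos √μ := by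
  rw [Real.sqrt_sq (cosGap_pos h0 h).le]
  have ha : √α ≤ 1 := Real.sqrt_le_one.2 h1
  have hm : √μ ≤ √α := Real.sqrt_le_sqrt h.le
  have key : cosGap μ α = Real.cos (Real.arccos √μ - Real.arccos √α) := by
    rw [Real.cos_sub, Real.sin_arccos, Real.sin_arccos, Real.cos_arccos, Real.cos_arccos,
      Real.sq_sqrt h0.le, Real.sq_sqrt (h0.trans h).le]
    · unfold cosGap; ring
    all_goals linarith [Real.sqrt_nonneg μ, Real.sqrt_nonneg α]
  rw [key, Real.arccos_cos]
  · ring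
  · linarith [Real.arccos_le_arccos hm]
  · linarith [Real.arccos_nonneg √α, Real.arccos_le_pi √μ]

/-- The left side is the cosine of arccos t - arccos √α. As t ≤ √μ < √α, the angle shrinks while t
grows, so the maximum is at the endpoint only. The proof replaces angles by algebra. -/
theorem add_le_cosGap {μ α t : ℝ} (h : μ < α) (h1 : α ≤ 1)
    (ht : 0 ≤ t) (htμ : t ≤ √μ) : √α * t + √(1 - α) * √(1 - t ^ 2) ≤ cosGap μ α ∧
      (cosGap μ α ≤ √α * t + √(1 - α) * √(1 - t ^ 2) → t = √μ) := by
  rcases eq_or_lt_of_le htμ with rfl | hlt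
  -- The sign of μ is not assumed; for μ < 0 the root √μ is 0 by convention.
  · have : √μ ^ 2 = μ ∨ μ < 0 := by
      rcases le_or_gt 0 μ with h | h
      · exact Or.inl (Real.sq_sqrt h)
      · exact Or.inr h
    refine ⟨?_, fun _ => rfl⟩
    rcases this with h | h
    · rw [h]; exact le_rfl
    · unfold cosGap
      have : √(1 - √μ ^ 2) ≤ √(1 - μ) := Real.sqrt_le_sqrt (by nlinarith [sq_nonneg √μ])
      gcongr
  · have h0 : 0 < μ := Real.sqrt_pos.1 (ht.trans_lt hlt)
    have hm2 := Real.sq_sqrt h0.le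
    have hm'2 := Real.sq_sqrt (by linarith : 0 ≤ 1 - μ)
    have htm : t ^ 2 ≤ μ := by nlinarith
    have ht2 := Real.sq_sqrt (by linarith : 0 ≤ 1 - t ^ 2)
    have ham : √μ < √α := Real.sqrt_lt_sqrt h0.le h
    have ha'm' : √(1 - α) < √(1 - μ) := Real.sqrt_lt_sqrt (by linarith) (by linarith)
    have hm't' : √(1 - μ) ≤ √(1 - t ^ 2) := Real.sqrt_le_sqrt (by linarith)
    have ha' := Real.sqrt_nonneg (1 - α)
    have hm := Real.sqrt_nonneg μ
    have key : √α * t + √(1 - α) * √(1 - t ^ 2) < cosGap μ α := by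
      unfold cosGap
      generalize √μ = m at *
      generalize √α = a at *
      generalize √(1 - μ) = m' at *
      generalize √(1 - α) = a' at *
      generalize √(1 - t ^ 2) = t' at *
      -- The goal is a' (t' - m') < a (m - t). Multiplication by t' + m' and t² + t'² = m² + m'²
      -- reduce it to a' (m + t) < a (t' + m').
      have hs : 0 < t' + m' := by linarith
      have e : (t' - m') * (t' + m') = (m - t) * (m + t) := by nlinarith
      have h5 : a' * (m + t) < a * (t' + m') := by
        have h6 : a' * m < a * m' :=
          (mul_le_mul_of_nonneg_left ham.le ha').trans_lt (by nlinarith)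
        have h7 : a' * t ≤ a * t' :=
          (mul_le_mul ha'm'.le (hlt.le.trans ham.le) ht (by linarith)).trans (by nlinarith)
        linarith
      have h8 : a' * (t' - m') * (t' + m') < a * (m - t) * (t' + m') := by
        have : a' * (m + t) * (m - t) < a * (t' + m') * (m - t) :=
          mul_lt_mul_of_pos_right h5 (by linarith)
        nlinarith
      have := lt_of_mul_lt_mul_right h8 hs.le
      linarith
    exact ⟨key.le, fun h => absurd h (not_le.2 key)⟩

/-- Equality case of Cauchy–Schwarz. Only b must be positive: a = 0 occurs when α = 1. -/
theorem eq_smul_of_inner_eq {u v : H} {a b : ℝ} (hb : 0 < b) (hu : ‖u‖ = a) (hv : ‖v‖ = b)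
    (h : a * b ≤ ⟪u, v⟫) : u = (a / b) • v := by
  have h1 : ‖u - (a / b) • v‖ ^ 2 ≤ 0 := by
    rw [norm_sub_sq_real, inner_smul_right, norm_smul, hu, hv, mul_pow, Real.norm_eq_abs, sq_abs]
    have h2 : 0 ≤ a / b := div_nonneg (hu ▸ norm_nonneg u) hb.le
    have h3 : a / b * (a * b) ≤ a / b * ⟪u, v⟫ := mul_le_mul_of_nonneg_left h h2
    have h4 : a / b * (a * b) = a ^ 2 := by field_simp
    have h5 : (a / b) ^ 2 * b ^ 2 = a ^ 2 := by field_simp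
    linarith
  have h5 : ‖u - (a / b) • v‖ = 0 := by
    nlinarith [norm_nonneg (u - (a / b) • v), sq_nonneg ‖u - (a / b) • v‖]
  exact sub_eq_zero.1 (norm_eq_zero.1 h5)

namespace IsOrthProj

/-- Cauchy–Schwarz is applied separately to the components in the range of D and in its complement,
and `add_le_cosGap` with t = ‖Dg‖ bounds the sum. -/
theorem inner_le_cosGap (hD : IsOrthProj D) (hB : IsOrthProj B) {μ α : ℝ} (h0 : 0 < μ)
    (hμ : ∀ x, ‖B (D x)‖ ^ 2 ≤ μ * ‖x‖ ^ 2) (h : μ < α) (h1 : α ≤ 1) {x g : H}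
    (hx : ‖x‖ = 1) (hxα : ‖D x‖ ^ 2 = α) (hg : ‖g‖ = 1) (hBg : B g = g) :
    ⟪x, g⟫ ≤ cosGap μ α ∧ (⟪x, g⟫ = cosGap μ α → B (D g) = μ • g ∧
      x = √((1 - α) / (1 - μ)) • g + (√(α / μ) - √((1 - α) / (1 - μ))) • D g) := by
  have hα0 : 0 ≤ α := by linarith
  have n1 : ‖D x‖ = √α := by rw [← hxα, Real.sqrt_sq (norm_nonneg _)]
  have n2 : ‖x - D x‖ = √(1 - α) := by
    rw [← hxα, ← Real.sqrt_sq (norm_nonneg (x - D x)), hD.norm_sub_sq, hx, one_pow]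
  have n3 : ‖g - D g‖ = √(1 - ‖D g‖ ^ 2) := by
    rw [← Real.sqrt_sq (norm_nonneg (g - D g)), hD.norm_sub_sq, hg, one_pow]
  have n4 : ‖D g‖ ≤ √μ := by
    apply Real.le_sqrt_of_sq_le
    simpa [hg] using hD.norm_sq_le_of_apply_eq hB hμ hBg
  have c1 := real_inner_le_norm (D x) (D g)
  have c2 := real_inner_le_norm (x - D x) (g - D g)
  rw [n1] at c1
  rw [n2, n3] at c2
  have e := hD.inner_eq_add x g
  obtain ⟨k1, k2⟩ := add_le_cosGap h h1 (norm_nonneg (D g)) n4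
  refine ⟨by linarith, fun heq => ?_⟩
  have t1 := k2 (by linarith)
  have t2 : ‖D g‖ ^ 2 = μ := by rw [t1, Real.sq_sqrt h0.le]
  refine ⟨hD.apply_eq_smul_of_norm_sq_eq hB hμ hBg (by rw [t2, hg]; ring), ?_⟩
  have hm : 0 < √μ := Real.sqrt_pos.2 h0
  have hm' : 0 < √(1 - μ) := Real.sqrt_pos.2 (by linarith)
  rw [t2] at n3 c2 k1
  rw [t1] at c1 k1
  rw [cosGap] at heq
  -- The sum of the two Cauchy–Schwarz bounds is attained, so each one is attained.
  have s1 := eq_smul_of_inner_eq hm n1 t1 (by linarith)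
  have s2 := eq_smul_of_inner_eq hm' n2 n3 (by linarith)
  rw [Real.sqrt_div (by linarith), Real.sqrt_div hα0]
  calc x = (x - D x) + D x := by abel
    _ = (√(1 - α) / √(1 - μ)) • (g - D g) + (√α / √μ) • D g := by rw [← s1, ← s2]
    _ = _ := by module

/-- Sharp bound for the concentration on the range of `B` of a unit vector of given concentration
on the range of `D`, with the case of equality. -/
theorem norm_sq_le_cosGap_sq (hD : IsOrthProj D) (hB : IsOrthProj B) {μ α : ℝ} (h0 : 0 < μ)
    (hμ : ∀ x, ‖B (D x)‖ ^ 2 ≤ μ * ‖x‖ ^ 2) (h : μ < α) (h1 : α ≤ 1) {x : H}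
    (hx : ‖x‖ = 1) (hxα : ‖D x‖ ^ 2 = α) :
    ‖B x‖ ^ 2 ≤ cosGap μ α ^ 2 ∧ (‖B x‖ ^ 2 = cosGap μ α ^ 2 →
      ∃ g, ‖g‖ = 1 ∧ B (D g) = μ • g ∧
      x = √((1 - α) / (1 - μ)) • g + (√(α / μ) - √((1 - α) / (1 - μ))) • D g) := by
  have hs := cosGap_pos h0 h
  rcases eq_or_ne (B x) 0 with hz | hz
  · rw [hz, norm_zero]
    have h2 : 0 < cosGap μ α ^ 2 := by positivity
    rw [zero_pow two_ne_zero]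
    exact ⟨h2.le, fun h => absurd h h2.ne⟩
  have hp : 0 < ‖B x‖ := norm_pos_iff.2 hz
  -- The test vector is the normalized Bx, for which ⟪x, g⟫ = ‖Bx‖.
  have hg : ‖(‖B x‖⁻¹ • B x : H)‖ = 1 := by
    rw [norm_smul, norm_inv, norm_norm, inv_mul_cancel₀ hp.ne']
  have hBg : B (‖B x‖⁻¹ • B x) = ‖B x‖⁻¹ • B x := by rw [map_smul, hB.idem]
  have hin : ⟪x, (‖B x‖⁻¹ • B x : H)⟫ = ‖B x‖ := by
    rw [inner_smul_right, real_inner_comm, hB.inner_self]; field_simp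
  obtain ⟨k1, k2⟩ := hD.inner_le_cosGap hB h0 hμ h h1 hx hxα hg hBg
  rw [hin] at k1 k2
  refine ⟨by gcongr, fun e => ?_⟩
  exact ⟨_, hg, k2 ((sq_eq_sq₀ hp.le hs.le).1 e)⟩

/-- The vectors attaining the bound `norm_sq_le_cosGap_sq`. -/
theorem extremal_of_eigen (hD : IsOrthProj D) (hB : IsOrthProj B) {μ α : ℝ} (h0 : 0 < μ)
    (h : μ < α) (h1 : α ≤ 1) {x g : H} (hg : ‖g‖ = 1) (he : B (D g) = μ • g)
    (hx : x = √((1 - α) / (1 - μ)) • g + (√(α / μ) - √((1 - α) / (1 - μ))) • D g) :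
    ‖x‖ = 1 ∧ ‖D x‖ ^ 2 = α ∧ ‖B x‖ ^ 2 = cosGap μ α ^ 2 := by
  have hα0 : 0 ≤ α := by linarith
  have hm : 0 < √μ := Real.sqrt_pos.2 h0
  have hm' : 0 < √(1 - μ) := Real.sqrt_pos.2 (by linarith)
  have hm2 := Real.sq_sqrt h0.le
  have hm'2 := Real.sq_sqrt (by linarith : 0 ≤ 1 - μ)
  rw [Real.sqrt_div (by linarith), Real.sqrt_div hα0] at hx
  have hBg := hB.apply_eq_self_of_eigen h0 he
  have hDg : ‖D g‖ ^ 2 = μ := by simpa [hg] using hD.norm_sq_of_eigen hB h0 he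
  -- The coefficients rescale Dg, of norm √μ, to norm √α, and g - Dg, of norm √(1-μ), to norm
  -- √(1-α).
  have hDx : D x = (√α / √μ) • D g := by
    rw [hx, map_add, map_smul, map_smul, hD.idem]; module
  have hxDx : x - D x = (√(1 - α) / √(1 - μ)) • (g - D g) := by rw [hDx, hx]; module
  have hBx : B x = cosGap μ α • g := by
    rw [hx, map_add, map_smul, map_smul, he, hBg, smul_smul, ← add_smul]
    congr 1
    unfold cosGap
    field_simp
    linear_combination (√(1 - μ) * √α - √(1 - α) * √μ) * hm2.symm +
      √(1 - α) * √μ * (-hm'2 - hm2)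
  have r1 : ‖D x‖ ^ 2 = α := by
    rw [hDx, norm_smul, mul_pow, hDg, Real.norm_eq_abs, sq_abs, div_pow, hm2, Real.sq_sqrt hα0]
    field_simp
  have r2 : ‖x - D x‖ ^ 2 = 1 - α := by
    have h2 : (1 - μ) ≠ 0 := by linarith
    rw [hxDx, norm_smul, mul_pow, hD.norm_sub_sq, hDg, hg, Real.norm_eq_abs, sq_abs, div_pow,
      hm'2, Real.sq_sqrt (by linarith)]
    field_simp
  refine ⟨?_, r1, ?_⟩
  · have := hD.norm_sub_sq x
    rw [r1, r2] at this
    have h3 : ‖x‖ ^ 2 = 1 := by linarith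
    nlinarith [norm_nonneg x]
  · rw [hBx, norm_smul, hg, mul_one, Real.norm_eq_abs, sq_abs]

/-- A maximizer of `‖B (D x)‖` on the unit sphere gives an eigenvector of `B D`. -/
theorem exists_eigen_of_max (hD : IsOrthProj D) (hB : IsOrthProj B) {μ : ℝ} (h0 : 0 < μ)
    (hμ : ∀ x, ‖B (D x)‖ ^ 2 ≤ μ * ‖x‖ ^ 2) {x : H} (hx : ‖x‖ = 1)
    (hmax : ‖B (D x)‖ ^ 2 = μ) : ∃ g, ‖g‖ = 1 ∧ B (D g) = μ • g := by
  have hμ' : ∀ x, ‖D (B x)‖ ^ 2 ≤ μ * ‖x‖ ^ 2 := fun y =>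
    (hD.norm_sq_le_of_apply_eq hB hμ (hB.idem y)).trans
      (by gcongr; exact hB.norm_apply_le y)
  have hn : ‖B (D x)‖ = √μ := by rw [← hmax, Real.sqrt_sq (norm_nonneg _)]
  have hp : 0 < √μ := Real.sqrt_pos.2 h0
  have hle : ‖D (B (D x))‖ ^ 2 ≤ μ ^ 2 := by
    have := hD.norm_sq_le_of_apply_eq hB hμ (hB.idem (D x))
    rwa [hmax, ← sq] at this
  -- With h = BDx, symmetry gives μ = ⟪Dh, x⟫ ≤ ‖Dh‖, while ‖Dh‖² ≤ μ‖h‖² = μ². Hence h is an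
  -- equality case of the bound on the range of B, and so an eigenvector.
  have hge : μ ≤ ‖D (B (D x))‖ := by
    calc μ = ⟪D (B (D x)), x⟫ := by rw [hD.symm, hB.inner_self, hmax]
      _ ≤ ‖D (B (D x))‖ := by simpa [hx] using real_inner_le_norm (D (B (D x))) x
  have heq : ‖D (B (D x))‖ ^ 2 = μ * ‖B (D x)‖ ^ 2 := by
    rw [hmax]; nlinarith
  have he := hD.apply_eq_smul_of_norm_sq_eq hB hμ (hB.idem (D x)) heq
  refine ⟨(√μ)⁻¹ • B (D x), ?_, ?_⟩
  · rw [norm_smul, hn, norm_inv, Real.norm_of_nonneg hp.le, inv_mul_cancel₀ hp.ne']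
  · rw [map_smul, map_smul, he, smul_comm]

end IsOrthProj

/-- On a separable Hilbert space, the operator norm of an operator that takes weakly convergent
sequences to convergent ones is attained. -/
theorem exists_norm_eq_opNorm {F : Type*} [NormedAddCommGroup F] [NormedSpace ℝ F]
    [CompleteSpace H] [SecondCountableTopology H] (K : H →L[ℝ] F) (hK0 : K ≠ 0)
    (hK : ∀ (u : ℕ → H) (x : H), (∀ n, ‖u n‖ ≤ 1) →
      (∀ y, Tendsto (fun n => ⟪u n, y⟫) atTop (𝓝 ⟪x, y⟫)) →
      Tendsto (fun n => K (u n)) atTop (𝓝 (K x))) :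
    ∃ x, ‖x‖ = 1 ∧ ‖K x‖ = ‖K‖ := by
  have hpos : 0 < ‖K‖ := norm_pos_iff.2 hK0
  have hseq : ∀ n : ℕ, ∃ x : H, ‖x‖ ≤ 1 ∧ ‖K‖ - 1 / (n + 1) < ‖K x‖ := fun n => by
    by_contra! hcon
    have hε : (0 : ℝ) < 1 / (n + 1) := by positivity
    -- The maximum with 0 keeps the candidate bound for the operator norm nonnegative.
    have : ‖K‖ ≤ max 0 (‖K‖ - 1 / (n + 1)) := by
      apply K.opNorm_le_of_unit_norm (le_max_left _ _)
      intro x hx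
      exact (hcon x hx.le).trans (le_max_right _ _)
    rcases le_max_iff.1 this with h | h <;> linarith
  choose u hu1 hu2 using hseq
  -- Sequential Banach–Alaoglu, carried to the Hilbert space by the Riesz isomorphism, gives a weak
  -- limit of the near-maximizers.
  have hcomp := WeakDual.isSeqCompact_closedBall ℝ H (0 : StrongDual ℝ H) 1
  let φ : ℕ → WeakDual ℝ H := fun n =>
    StrongDual.toWeakDual (InnerProductSpace.toDual ℝ H (u n))
  have hφ : ∀ n, φ n ∈ WeakDual.toStrongDual ⁻¹' Metric.closedBall (0 : StrongDual ℝ H) 1 := by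
    intro n
    simp only [Set.mem_preimage, Metric.mem_closedBall, dist_zero_right]
    change ‖InnerProductSpace.toDual ℝ H (u n)‖ ≤ 1
    simpa using hu1 n
  obtain ⟨ψ, hψ, θ, hθ, hlim⟩ := hcomp hφ
  obtain ⟨x, hx⟩ := (InnerProductSpace.toDual ℝ H).surjective (WeakDual.toStrongDual ψ)
  have hxn : ‖x‖ ≤ 1 := by
    rw [← (InnerProductSpace.toDual ℝ H).norm_map x, hx]
    simpa using hψ
  have hw : ∀ y, Tendsto (fun n => ⟪u (θ n), y⟫) atTop (𝓝 ⟪x, y⟫) := by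
    intro y
    have h1 := ((WeakDual.eval_continuous y).tendsto ψ).comp hlim
    have h2 : ψ y = ⟪x, y⟫ := by
      rw [← InnerProductSpace.toDual_apply_apply (𝕜 := ℝ), hx]; rfl
    rw [h2] at h1
    exact h1
  have hlimK := (hK (fun n => u (θ n)) x (fun n => hu1 _) hw).norm
  have hge : ‖K‖ ≤ ‖K x‖ := by
    have h3 : Tendsto (fun n : ℕ => ‖K‖ - 1 / ((θ n : ℕ) + 1 : ℝ)) atTop (𝓝 (‖K‖ - 0)) :=
      tendsto_const_nhds.sub (tendsto_one_div_add_atTop_nhds_zero_nat.comp hθ.tendsto_atTop)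
    rw [sub_zero] at h3
    exact le_of_tendsto_of_tendsto' h3 hlimK fun n => (hu2 (θ n)).le
  have hle := K.le_opNorm x
  have h4 : ‖x‖ = 1 := by
    apply le_antisymm hxn
    -- A limit of norm below 1 would give ‖Kx‖ < ‖K‖.
    by_contra! hlt
    nlinarith
  exact ⟨x, h4, le_antisymm (by simpa [h4] using hle) hge⟩

end Projections

/-! ### The Fourier transform of integrable functions in `L²` -/

section Scalar

open FourierTransform SchwartzMap
open scoped ContDiff

variable {V : Type*} [NormedAddCommGroup V] [InnerProductSpace ℝ V] [FiniteDimensional ℝ V]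
  [MeasurableSpace V] [BorelSpace V]

theorem continuous_fourier_of_integrable {f : V → ℂ} (hf : Integrable f) : Continuous (𝓕 f) :=
  VectorFourier.fourierIntegral_continuous (L := innerₗ V) Real.continuous_fourierChar
    continuous_inner hf

theorem continuous_fourierInv_of_integrable {f : V → ℂ} (hf : Integrable f) :
    Continuous (𝓕⁻ f) :=
  VectorFourier.fourierIntegral_continuous (L := -innerₗ V) Real.continuous_fourierChar
    (continuous_inner (𝕜 := ℝ) (E := V)).neg hf

/-- Both transforms have the same pairing with every test function: the `L²` one through tempered
distributions, the integral one by Fubini. -/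
theorem fourier_toLp_ae_eq (f : Lp (α := V) ℂ 2) (hf : Integrable f) :
    ((𝓕 f : Lp (α := V) ℂ 2) : V → ℂ) =ᵐ[volume] 𝓕 (f : V → ℂ) := by
  refine ae_eq_of_integral_contDiff_smul_eq ((Lp.memLp _).locallyIntegrable (by norm_num))
    (continuous_fourier_of_integrable hf).locallyIntegrable fun g hg hgc => ?_
  have hg₁ : HasCompactSupport (Complex.ofRealCLM ∘ g) := hgc.comp_left rfl
  have hg₂ : ContDiff ℝ ∞ (Complex.ofRealCLM ∘ g) := by fun_prop
  set φ : 𝓢(V, ℂ) := hg₁.toSchwartzMap hg₂ with hφ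
  have h1 := congrArg (fun T => T φ) (Lp.fourier_toTemperedDistribution_eq f)
  simp only [TemperedDistribution.fourier_apply, Lp.toTemperedDistribution_apply] at h1
  have h2 : ∫ x, (𝓕 φ) x • (f : V → ℂ) x = ∫ x, φ x • 𝓕 (f : V → ℂ) x := by
    simpa using! VectorFourier.integral_fourierIntegral_smul_eq_flip (L := innerₗ V)
      Real.continuous_fourierChar continuous_inner φ.integrable hf
  rw [h2] at h1
  simpa [hφ] using h1.symm

theorem fourierInv_toLp_ae_eq (f : Lp (α := V) ℂ 2) (hf : Integrable f) :
    ((𝓕⁻ f : Lp (α := V) ℂ 2) : V → ℂ) =ᵐ[volume] 𝓕⁻ (f : V → ℂ) := by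
  refine ae_eq_of_integral_contDiff_smul_eq ((Lp.memLp _).locallyIntegrable (by norm_num))
    (continuous_fourierInv_of_integrable hf).locallyIntegrable fun g hg hgc => ?_
  have hg₁ : HasCompactSupport (Complex.ofRealCLM ∘ g) := hgc.comp_left rfl
  have hg₂ : ContDiff ℝ ∞ (Complex.ofRealCLM ∘ g) := by fun_prop
  set φ : 𝓢(V, ℂ) := hg₁.toSchwartzMap hg₂ with hφ
  have h1 := congrArg (fun T => T φ) (Lp.fourierInv_toTemperedDistribution_eq f)
  simp only [TemperedDistribution.fourierInv_apply, Lp.toTemperedDistribution_apply] at h1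
  have h2 : ∫ x, (𝓕⁻ φ) x • (f : V → ℂ) x = ∫ x, φ x • 𝓕⁻ (f : V → ℂ) x := by
    have hflip : (-innerₗ V).flip = -innerₗ V := by
      ext x y; simp [real_inner_comm]
    have := VectorFourier.integral_fourierIntegral_smul_eq_flip (μ := (volume : Measure V))
      (ν := (volume : Measure V)) (L := -innerₗ V) Real.continuous_fourierChar
      (continuous_inner (𝕜 := ℝ) (E := V)).neg (φ.integrable (μ := (volume : Measure V))) hf
    rw [hflip] at this
    rw [SchwartzMap.fourierInv_coe]
    exact this
  rw [h2] at h1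
  simpa [hφ] using h1.symm

/-- The Fourier transform of an integrable function of bounded support is analytic along lines;
if it vanishes on a nonempty open set, it vanishes identically. -/
theorem fourier_eq_zero_of_bounded_support {f : V → ℂ} (hf : Integrable f) {C : ℝ}
    (hC : ∀ᵐ x, f x ≠ 0 → ‖x‖ ≤ C) {O : Set V} (hO : IsOpen O) (hne : O.Nonempty)
    (hz : ∀ w ∈ O, 𝓕 f w = 0) (w : V) : 𝓕 f w = 0 := by
  obtain ⟨w₀, hw₀⟩ := hne
  set d := w - w₀
  -- G extends the transform along the line from w₀ to w to an entire function of s, with s = 1 at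
  -- w. It vanishes for real s near 0, hence everywhere.
  let c : V → ℂ := fun v => (-2 * Real.pi * inner ℝ v d : ℝ) * Complex.I
  let h : V → ℂ := fun v => Complex.exp ((-2 * Real.pi * inner ℝ v w₀ : ℝ) * Complex.I) * f v
  let G : ℂ → ℂ := fun s => ∫ v, Complex.exp (s * c v) * h v
  have hc : Continuous c := by fun_prop
  have hh : Integrable h := by
    refine hf.bdd_mul (c := 1) (by fun_prop) (Eventually.of_forall fun v => ?_)
    rw [Complex.norm_exp_ofReal_mul_I]
  have hGf : ∀ t : ℝ, G t = 𝓕 f (w₀ + t • d) := by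
    intro t
    simp only [G, Real.fourier_eq']
    congr 1
    ext v
    simp only [h, c, smul_eq_mul, ← mul_assoc, ← Complex.exp_add]
    congr 2
    rw [inner_add_right, inner_smul_right]
    push_cast
    ring
  have hcb : ∀ v, ‖v‖ ≤ C → ‖c v‖ ≤ 2 * Real.pi * (C * ‖d‖) := by
    intro v hv
    simp only [c, norm_mul, Complex.norm_I, mul_one, Complex.norm_real, Real.norm_eq_abs]
    have h2 : |(-2 : ℝ)| = 2 := by norm_num
    rw [h2, abs_of_pos Real.pi_pos]
    gcongr
    exact (abs_real_inner_le_norm v d).trans (by gcongr)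
  have hdiff : Differentiable ℂ G := by
    intro s₀
    set M := 2 * Real.pi * (C * ‖d‖)
    set R := ‖s₀‖ + 1
    have hR : 0 ≤ R := by positivity
    have key := hasDerivAt_integral_of_dominated_loc_of_deriv_le (μ := (volume : Measure V))
      (F := fun s v => Complex.exp (s * c v) * h v)
      (F' := fun s v => Complex.exp (s * c v) * c v * h v) (x₀ := s₀)
      (bound := fun v => Real.exp (R * M) * M * ‖h v‖)
      (s := Metric.ball s₀ 1) (Metric.ball_mem_nhds _ one_pos)
    -- On the support |c| ≤ M, and |s| ≤ R in the unit ball around s₀; this gives an integrable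
    -- bound for the s-derivative.
    have hbd : ∀ v, (f v ≠ 0 → ‖v‖ ≤ C) → ∀ s ∈ Metric.ball s₀ 1, h v = 0 ∨
        (‖c v‖ ≤ M ∧ ‖Complex.exp (s * c v)‖ ≤ Real.exp (R * M)) := by
      intro v hv s hs
      by_cases h0 : f v = 0
      · exact Or.inl (by simp [h, h0])
      · refine Or.inr ⟨hcb v (hv h0), (Complex.norm_exp_le_exp_norm _).trans ?_⟩
        rw [norm_mul]
        have : ‖s‖ ≤ R := by
          have h1 : ‖s - s₀‖ < 1 := by simpa [dist_eq_norm] using hs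
          have h3 : ‖s‖ ≤ ‖s₀‖ + ‖s - s₀‖ := by
            simpa using norm_add_le s₀ (s - s₀)
          simp only [R]; linarith
        gcongr
        exact hcb v (hv h0)
    refine (key ?_ ?_ ?_ ?_ ?_ ?_).2.differentiableAt
    · refine Eventually.of_forall fun s => ?_
      exact (by fun_prop : Continuous fun v => Complex.exp (s * c v)).aestronglyMeasurable.mul
        hh.aestronglyMeasurable
    · refine (hh.norm.const_mul (Real.exp (R * M))).mono' ?_ ?_
      · exact (by fun_prop : Continuous fun v => Complex.exp (s₀ * c v)).aestronglyMeasurable.mul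
          hh.aestronglyMeasurable
      · filter_upwards [hC] with v hv
        rcases hbd v hv s₀ (Metric.mem_ball_self one_pos) with h0 | ⟨-, h2⟩
        · simp [h0]
        · rw [norm_mul]; gcongr
    · exact (by fun_prop :
        Continuous fun v => Complex.exp (s₀ * c v) * c v).aestronglyMeasurable.mul
          hh.aestronglyMeasurable
    · filter_upwards [hC] with v hv s hs
      rcases hbd v hv s hs with h0 | ⟨h1, h2⟩
      · simp [h0]
      · rw [norm_mul, norm_mul]; gcongr
    · exact hh.norm.const_mul _
    · refine Eventually.of_forall fun v s _ => ?_
      simpa using (((hasDerivAt_id s).mul_const (c v)).cexp).mul_const (h v)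
  have hGz : ∀ᶠ t : ℝ in 𝓝 0, G t = 0 := by
    have h1 : Tendsto (fun t : ℝ => w₀ + t • d) (𝓝 0) (𝓝 w₀) := by
      have : Continuous fun t : ℝ => w₀ + t • d := by fun_prop
      simpa using this.tendsto 0
    filter_upwards [h1.eventually (hO.mem_nhds hw₀)] with t ht
    rw [hGf, hz _ ht]
  have hfreq : ∃ᶠ s : ℂ in 𝓝[≠] 0, G s = 0 := by
    have h1 : Tendsto (fun t : ℝ => (t : ℂ)) (𝓝[≠] 0) (𝓝[≠] 0) := by
      refine tendsto_nhdsWithin_iff.2 ⟨?_, ?_⟩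
      · exact (Complex.continuous_ofReal.tendsto' 0 0 (by simp)).mono_left nhdsWithin_le_nhds
      · filter_upwards [self_mem_nhdsWithin] with t ht
        simpa using ht
    exact h1.frequently (hGz.filter_mono nhdsWithin_le_nhds).frequently
  have hG0 : ∀ s, G s = 0 := by
    have := AnalyticOnNhd.eqOn_zero_of_preconnected_of_frequently_eq_zero
      (hdiff.differentiableOn.analyticOnNhd isOpen_univ) isPreconnected_univ (Set.mem_univ 0) hfreq
    exact fun s => this (Set.mem_univ s)
  have := hGf 1
  rw [hG0] at this
  rw [this]
  simp [d]

end Scalar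

/-! ### Splitting the quaternions into two complex lines -/

section Splitting

@[simp] theorem complexI_re (z : ℂ) : (complexI z).re = z.re := rfl

@[simp] theorem complexI_imI (z : ℂ) : (complexI z).imI = z.im := rfl

@[simp] theorem complexI_imJ (z : ℂ) : (complexI z).imJ = 0 := rfl

@[simp] theorem complexI_imK (z : ℂ) : (complexI z).imK = 0 := rfl

@[simp] theorem complexJ_re (z : ℂ) : (complexJ z).re = z.re := rfl

@[simp] theorem complexJ_imI (z : ℂ) : (complexJ z).imI = 0 := rfl

@[simp] theorem complexJ_imJ (z : ℂ) : (complexJ z).imJ = z.im := rfl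

@[simp] theorem complexJ_imK (z : ℂ) : (complexJ z).imK = 0 := rfl

@[simp] theorem complexI_mul (z w : ℂ) : complexI (z * w) = complexI z * complexI w := by
  apply Quaternion.ext <;> simp

@[simp] theorem complexJ_mul (z w : ℂ) : complexJ (z * w) = complexJ z * complexJ w := by
  apply Quaternion.ext <;> simp

@[simp] theorem complexI_one : complexI 1 = 1 := by
  apply Quaternion.ext <;> rfl

@[simp] theorem complexJ_one : complexJ 1 = 1 := by
  apply Quaternion.ext <;> rfl

theorem norm_sq_eq_sum (q : Quaternion ℝ) :
    ‖q‖ ^ 2 = q.re ^ 2 + q.imI ^ 2 + q.imJ ^ 2 + q.imK ^ 2 := by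
  rw [sq, ← Quaternion.normSq_eq_norm_mul_self, Quaternion.normSq_def']

@[simp] theorem norm_complexI (z : ℂ) : ‖complexI z‖ = ‖z‖ := by
  rw [← sq_eq_sq₀ (norm_nonneg _) (norm_nonneg _), norm_sq_eq_sum, ← Complex.normSq_eq_norm_sq,
    Complex.normSq_apply]
  simp; ring

@[simp] theorem norm_complexJ (z : ℂ) : ‖complexJ z‖ = ‖z‖ := by
  rw [← sq_eq_sq₀ (norm_nonneg _) (norm_nonneg _), norm_sq_eq_sum, ← Complex.normSq_eq_norm_sq,
    Complex.normSq_apply]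
  simp; ring

/-- `complexI` as a continuous linear map. -/
def complexICLM : ℂ →L[ℝ] Quaternion ℝ :=
  LinearMap.toContinuousLinearMap
    { toFun := complexI
      map_add' := fun z w => by apply Quaternion.ext <;> simp
      map_smul' := fun c z => by apply Quaternion.ext <;> simp }

/-- `complexJ` as a continuous linear map. -/
def complexJCLM : ℂ →L[ℝ] Quaternion ℝ :=
  LinearMap.toContinuousLinearMap
    { toFun := complexJ
      map_add' := fun z w => by apply Quaternion.ext <;> simp
      map_smul' := fun c z => by apply Quaternion.ext <;> simp }

@[simp] theorem complexICLM_apply (z : ℂ) : complexICLM z = complexI z := rfl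

@[simp] theorem complexJCLM_apply (z : ℂ) : complexJCLM z = complexJ z := rfl

@[fun_prop] theorem continuous_complexI : Continuous complexI := complexICLM.continuous

@[fun_prop] theorem continuous_complexJ : Continuous complexJ := complexJCLM.continuous

/-- The coordinate on the complex line `{q | i q j = q}`, spanned by `1 + k`. -/
def plusCoord : Quaternion ℝ →L[ℝ] ℂ :=
  LinearMap.toContinuousLinearMap
    { toFun := fun q => ⟨(q.re + q.imK) / 2, (q.imI - q.imJ) / 2⟩
      map_add' := fun p q => by apply Complex.ext <;> simp <;> ring
      map_smul' := fun c q => by apply Complex.ext <;> simp <;> ring }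

/-- The coordinate on the complex line `{q | i q j = -q}`, spanned by `1 - k`. -/
def minusCoord : Quaternion ℝ →L[ℝ] ℂ :=
  LinearMap.toContinuousLinearMap
    { toFun := fun q => ⟨(q.re - q.imK) / 2, (q.imI + q.imJ) / 2⟩
      map_add' := fun p q => by apply Complex.ext <;> simp <;> ring
      map_smul' := fun c q => by apply Complex.ext <;> simp <;> ring }

/-- The quaternion `1 + k`. -/
def plusUnit : Quaternion ℝ := ⟨1, 0, 0, 1⟩

@[simp] theorem plusUnit_re : plusUnit.re = 1 := rfl

@[simp] theorem plusUnit_imI : plusUnit.imI = 0 := rfl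

@[simp] theorem plusUnit_imJ : plusUnit.imJ = 0 := rfl

@[simp] theorem plusUnit_imK : plusUnit.imK = 1 := rfl

/-- The quaternion `1 - k`. -/
def minusUnit : Quaternion ℝ := ⟨1, 0, 0, -1⟩

@[simp] theorem minusUnit_re : minusUnit.re = 1 := rfl

@[simp] theorem minusUnit_imI : minusUnit.imI = 0 := rfl

@[simp] theorem minusUnit_imJ : minusUnit.imJ = 0 := rfl

@[simp] theorem minusUnit_imK : minusUnit.imK = -1 := rfl

/-- The map `z ↦ z (1 + k)`. -/
def plusIncl : ℂ →L[ℝ] Quaternion ℝ :=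
  (ContinuousLinearMap.mul ℝ (Quaternion ℝ)).flip plusUnit ∘L complexICLM

/-- The map `z ↦ z (1 - k)`. -/
def minusIncl : ℂ →L[ℝ] Quaternion ℝ :=
  (ContinuousLinearMap.mul ℝ (Quaternion ℝ)).flip minusUnit ∘L complexICLM

theorem plusCoord_apply (q : Quaternion ℝ) :
    plusCoord q = ⟨(q.re + q.imK) / 2, (q.imI - q.imJ) / 2⟩ := rfl

theorem minusCoord_apply (q : Quaternion ℝ) :
    minusCoord q = ⟨(q.re - q.imK) / 2, (q.imI + q.imJ) / 2⟩ := rfl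

theorem plusIncl_apply (z : ℂ) : plusIncl z = complexI z * plusUnit := rfl

theorem minusIncl_apply (z : ℂ) : minusIncl z = complexI z * minusUnit := rfl

theorem plusCoord_incl (z w : ℂ) : plusCoord (plusIncl z + minusIncl w) = z := by
  apply Complex.ext <;> simp [plusCoord_apply, plusIncl_apply, minusIncl_apply]; ring

theorem minusCoord_incl (z w : ℂ) : minusCoord (plusIncl z + minusIncl w) = w := by
  apply Complex.ext <;> simp [minusCoord_apply, plusIncl_apply, minusIncl_apply]; ring

/-- On the line i q j = q one has q j = -i q, so a right factor from the j-copy of ℂ acts as its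
conjugate from the left. On the other line q j = i q and there is no conjugation. -/
theorem plusCoord_mul (z w : ℂ) (q : Quaternion ℝ) :
    plusCoord (complexI z * q * complexJ w) = z * (starRingEnd ℂ) w * plusCoord q := by
  apply Complex.ext <;> simp [plusCoord_apply] <;> ring

theorem minusCoord_mul (z w : ℂ) (q : Quaternion ℝ) :
    minusCoord (complexI z * q * complexJ w) = z * w * minusCoord q := by
  apply Complex.ext <;> simp [minusCoord_apply] <;> ring

/-- The two lines are orthogonal, and |1 ± k|² = 2. -/
theorem norm_sq_eq_coord (q : Quaternion ℝ) :
    ‖q‖ ^ 2 = 2 * (‖plusCoord q‖ ^ 2 + ‖minusCoord q‖ ^ 2) := by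
  rw [norm_sq_eq_sum, ← Complex.normSq_eq_norm_sq, ← Complex.normSq_eq_norm_sq,
    Complex.normSq_apply, Complex.normSq_apply, plusCoord_apply, minusCoord_apply]
  ring

theorem eq_of_coord {p q : Quaternion ℝ} (h₁ : plusCoord p = plusCoord q)
    (h₂ : minusCoord p = minusCoord q) : p = q := by
  have : ‖p - q‖ ^ 2 = 0 := by simp [norm_sq_eq_coord, h₁, h₂]
  simpa [sub_eq_zero] using this

end Splitting

/-! ### The two-sided quaternionic Fourier transform -/

section QuaternionFourier

open FourierTransform

/-- Square-integrable quaternionic signals. -/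
abbrev Signal : Type := Lp (Quaternion ℝ) 2 (volume : Measure (ℝ × ℝ))

/-- Separability is what `exists_norm_eq_opNorm` needs to extract weakly convergent subsequences. -/
instance : SecondCountableTopology Signal := by
  have : ProperSpace (Quaternion ℝ) := FiniteDimensional.proper ℝ _
  have : Fact ((2 : ENNReal) ≠ ⊤) := ⟨by norm_num⟩
  infer_instance

/-- The phase factor `exp (I t)`. -/
def phase (t : ℝ) : ℂ := Complex.exp (Complex.I * (t : ℝ))

@[simp] theorem norm_phase (t : ℝ) : ‖phase t‖ = 1 := by
  rw [phase, mul_comm, Complex.norm_exp_ofReal_mul_I]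

@[fun_prop] theorem continuous_phase : Continuous phase := by unfold phase; fun_prop

theorem phase_add (s t : ℝ) : phase (s + t) = phase s * phase t := by
  rw [phase, phase, phase, ← Complex.exp_add]; push_cast; ring_nf

@[simp] theorem phase_zero : phase 0 = 1 := by simp [phase]

theorem conj_phase (t : ℝ) : (starRingEnd ℂ) (phase t) = phase (-t) := by
  rw [phase, phase, ← Complex.exp_conj]; simp

/-- The two-sided quaternionic Fourier integral, with sign `s` in the exponents. -/
def fourierIntegral (s : ℝ) (f : ℝ × ℝ → Quaternion ℝ) (w : ℝ × ℝ) : Quaternion ℝ :=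
  ∫ z : ℝ × ℝ, complexI (phase (s * (2 * Real.pi) * (z.1 * w.1))) * f z *
    complexJ (phase (s * (2 * Real.pi) * (z.2 * w.2)))

theorem norm_phase_mul (a b : ℝ) (q : Quaternion ℝ) :
    ‖complexI (phase a) * q * complexJ (phase b)‖ = ‖q‖ := by simp

theorem integrable_phase_mul {f : ℝ × ℝ → Quaternion ℝ} {μ : Measure (ℝ × ℝ)}
    (hf : Integrable f μ) {a b : ℝ × ℝ → ℝ} (ha : Continuous a) (hb : Continuous b) :
    Integrable (fun z => complexI (phase (a z)) * f z * complexJ (phase (b z))) μ := by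
  refine hf.mono ?_ (Eventually.of_forall fun z => by rw [norm_phase_mul])
  exact ((by fun_prop : Continuous fun z => complexI (phase (a z))).aestronglyMeasurable.mul
    hf.1).mul (by fun_prop : Continuous fun z => complexJ (phase (b z))).aestronglyMeasurable

theorem plusCoord_fourierIntegral (s : ℝ) {f : ℝ × ℝ → Quaternion ℝ} (hf : Integrable f)
    (w : ℝ × ℝ) : plusCoord (fourierIntegral s f w) =
      ∫ z : ℝ × ℝ, phase (s * (2 * Real.pi) * (z.1 * w.1 - z.2 * w.2)) * plusCoord (f z) := by
  rw [fourierIntegral, ← ContinuousLinearMap.integral_comp_comm _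
    (integrable_phase_mul hf (by fun_prop) (by fun_prop))]
  congr 1; ext z
  rw [plusCoord_mul, conj_phase, ← phase_add]
  ring_nf

theorem minusCoord_fourierIntegral (s : ℝ) {f : ℝ × ℝ → Quaternion ℝ} (hf : Integrable f)
    (w : ℝ × ℝ) : minusCoord (fourierIntegral s f w) =
      ∫ z : ℝ × ℝ, phase (s * (2 * Real.pi) * (z.1 * w.1 + z.2 * w.2)) * minusCoord (f z) := by
  rw [fourierIntegral, ← ContinuousLinearMap.integral_comp_comm _
    (integrable_phase_mul hf (by fun_prop) (by fun_prop))]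
  congr 1; ext z
  rw [minusCoord_mul, ← phase_add]
  ring_nf

/-- The Euclidean plane. -/
abbrev Plane : Type := WithLp 2 (ℝ × ℝ)

/-- Standard coordinates on the plane. -/
def planeEquiv : Plane ≃ᵐ ℝ × ℝ := (MeasurableEquiv.toLp 2 (ℝ × ℝ)).symm

/-- Coordinates on the plane, the second one reversed. -/
def planeEquivNeg : Plane ≃ᵐ ℝ × ℝ :=
  planeEquiv.trans ((MeasurableEquiv.refl ℝ).prodCongr (MeasurableEquiv.neg ℝ))

@[simp] theorem planeEquiv_apply (v : Plane) : planeEquiv v = (v.fst, v.snd) := rfl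

@[simp] theorem planeEquivNeg_apply (v : Plane) : planeEquivNeg v = (v.fst, -v.snd) := rfl

theorem measurePreserving_planeEquiv : MeasurePreserving planeEquiv :=
  WithLp.volume_preserving_ofLp ℝ ℝ

theorem measurePreserving_planeEquivNeg : MeasurePreserving planeEquivNeg :=
  ((MeasurePreserving.id volume).prod (Measure.measurePreserving_neg volume)).comp
    measurePreserving_planeEquiv

theorem norm_sq_eq_integral {α F : Type*} [MeasurableSpace α] {μ : Measure α}
    [NormedAddCommGroup F] [InnerProductSpace ℝ F] (f : Lp F 2 μ) :
    ‖f‖ ^ 2 = ∫ x, ‖f x‖ ^ 2 ∂μ := by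
  rw [← real_inner_self_eq_norm_sq, L2.inner_def]
  simp only [real_inner_self_eq_norm_sq]

section Split

variable {e : Plane ≃ᵐ ℝ × ℝ} (he : MeasurePreserving e)

/-- The two complex coordinates of a signal, the first one in the coordinates `e`. -/
def splitₗ (he : MeasurePreserving e) :
    Signal →ₗ[ℝ] Lp (α := Plane) ℂ 2 × Lp (α := Plane) ℂ 2 :=
  ((Lp.compMeasurePreservingₗ ℝ e he).comp (plusCoord.compLpₗ 2 volume)).prod
    ((Lp.compMeasurePreservingₗ ℝ planeEquiv measurePreserving_planeEquiv).comp
      (minusCoord.compLpₗ 2 volume))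

theorem splitₗ_fst_ae (f : Signal) :
    ((splitₗ he f).1 : Plane → ℂ) =ᵐ[volume] fun v => plusCoord (f (e v)) := by
  refine (Lp.coeFn_compMeasurePreserving _ he).trans ?_
  exact he.quasiMeasurePreserving.ae_eq_comp (plusCoord.coeFn_compLp f)

theorem splitₗ_snd_ae (f : Signal) :
    ((splitₗ he f).2 : Plane → ℂ) =ᵐ[volume] fun v => minusCoord (f (planeEquiv v)) := by
  refine (Lp.coeFn_compMeasurePreserving _ measurePreserving_planeEquiv).trans ?_
  exact measurePreserving_planeEquiv.quasiMeasurePreserving.ae_eq_comp (minusCoord.coeFn_compLp f)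

theorem norm_sq_splitₗ (f : Signal) :
    ‖f‖ ^ 2 = 2 * (‖(splitₗ he f).1‖ ^ 2 + ‖(splitₗ he f).2‖ ^ 2) := by
  have h1 : ‖(splitₗ he f).1‖ = ‖plusCoord.compLp f‖ := Lp.norm_compMeasurePreserving _ he
  have h2 : ‖(splitₗ he f).2‖ = ‖minusCoord.compLp f‖ :=
    Lp.norm_compMeasurePreserving _ measurePreserving_planeEquiv
  have i1 := (Lp.memLp (plusCoord.compLp f)).integrable_norm_pow two_ne_zero
  have i2 := (Lp.memLp (minusCoord.compLp f)).integrable_norm_pow two_ne_zero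
  rw [h1, h2, norm_sq_eq_integral, norm_sq_eq_integral, norm_sq_eq_integral,
    ← integral_add i1 i2, ← integral_const_mul]
  refine integral_congr_ae ?_
  filter_upwards [plusCoord.coeFn_compLp f, minusCoord.coeFn_compLp f] with z h1 h2
  rw [h1, h2, norm_sq_eq_coord]

theorem splitₗ_surjective : Function.Surjective (splitₗ he) := by
  rintro ⟨g, h⟩
  have he' : MeasurePreserving e.symm := he.symm e
  have hp' : MeasurePreserving planeEquiv.symm := measurePreserving_planeEquiv.symm planeEquiv
  let f : Signal := plusIncl.compLp (Lp.compMeasurePreserving _ he' g) +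
    minusIncl.compLp (Lp.compMeasurePreserving _ hp' h)
  have hf : (f : ℝ × ℝ → Quaternion ℝ) =ᵐ[volume]
      fun z => plusIncl (g (e.symm z)) + minusIncl (h (planeEquiv.symm z)) := by
    filter_upwards [Lp.coeFn_add (plusIncl.compLp (Lp.compMeasurePreserving _ he' g))
      (minusIncl.compLp (Lp.compMeasurePreserving _ hp' h)), plusIncl.coeFn_compLp
      (Lp.compMeasurePreserving _ he' g), minusIncl.coeFn_compLp
      (Lp.compMeasurePreserving _ hp' h), Lp.coeFn_compMeasurePreserving g he',
      Lp.coeFn_compMeasurePreserving h hp'] with z h1 h2 h3 h4 h5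
    rw [h1, Pi.add_apply, h2, h3, h4, h5]; rfl
  refine ⟨f, Prod.ext (Lp.ext ?_) (Lp.ext ?_)⟩
  · filter_upwards [splitₗ_fst_ae he f, he.quasiMeasurePreserving.ae_eq_comp hf] with v h1 h2
    simp only [Function.comp_apply] at h2
    rw [h1, h2, plusCoord_incl, MeasurableEquiv.symm_apply_apply]
  · filter_upwards [splitₗ_snd_ae he f,
      measurePreserving_planeEquiv.quasiMeasurePreserving.ae_eq_comp hf] with v h1 h2
    simp only [Function.comp_apply] at h2
    rw [h1, h2, minusCoord_incl, MeasurableEquiv.symm_apply_apply]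

/-- `splitₗ` as a linear equivalence. -/
def split (he : MeasurePreserving e) :
    Signal ≃ₗ[ℝ] Lp (α := Plane) ℂ 2 × Lp (α := Plane) ℂ 2 :=
  LinearEquiv.ofBijective (splitₗ he) ⟨by
    refine (injective_iff_map_eq_zero _).2 fun f hf => ?_
    have := norm_sq_splitₗ he f
    simpa [hf] using this, splitₗ_surjective he⟩

@[simp] theorem split_apply (f : Signal) : split he f = splitₗ he f := rfl

end Split

/-- The complex Fourier transform on `L²` of the plane, as a real linear equivalence. -/
def planeFourier : Lp (α := Plane) ℂ 2 ≃ₗ[ℝ] Lp (α := Plane) ℂ 2 :=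
  (Lp.fourierTransformₗᵢ Plane ℂ).toLinearEquiv.restrictScalars ℝ

theorem planeFourier_apply (f : Lp (α := Plane) ℂ 2) : planeFourier f = 𝓕 f := rfl

/-- The two-sided quaternionic Fourier transform on square-integrable signals. -/
def qft : Signal ≃ₗᵢ[ℝ] Signal where
  -- Reversing the second space variable in the plus coordinate, on the source side only, undoes the
  -- conjugation of the j-kernel; both coordinates then undergo the ordinary Fourier transform.
  toLinearEquiv := (split measurePreserving_planeEquivNeg).trans
    ((planeFourier.prodCongr planeFourier).trans (split measurePreserving_planeEquiv).symm)
  norm_map' f := by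
    rw [← sq_eq_sq₀ (norm_nonneg _) (norm_nonneg _), norm_sq_splitₗ measurePreserving_planeEquiv,
      norm_sq_splitₗ measurePreserving_planeEquivNeg]
    simp only [← split_apply, LinearEquiv.trans_apply, LinearEquiv.apply_symm_apply]
    simp [planeFourier_apply]

theorem split_qft (f : Signal) : splitₗ measurePreserving_planeEquiv (qft f) =
    (𝓕 (splitₗ measurePreserving_planeEquivNeg f).1,
      𝓕 (splitₗ measurePreserving_planeEquivNeg f).2) :=
  (split measurePreserving_planeEquiv).apply_symm_apply _

theorem split_qft_symm (f : Signal) : splitₗ measurePreserving_planeEquivNeg (qft.symm f) =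
    (𝓕⁻ (splitₗ measurePreserving_planeEquiv f).1,
      𝓕⁻ (splitₗ measurePreserving_planeEquiv f).2) :=
  (split measurePreserving_planeEquivNeg).apply_symm_apply _

theorem integrable_splitₗ {e : Plane ≃ᵐ ℝ × ℝ} (he : MeasurePreserving e) {f : Signal}
    (hf : Integrable f) :
    Integrable ((splitₗ he f).1 : Plane → ℂ) ∧ Integrable ((splitₗ he f).2 : Plane → ℂ) := by
  constructor
  · refine (integrable_congr (splitₗ_fst_ae he f)).2 ?_
    exact he.integrable_comp_of_integrable (plusCoord.integrable_comp hf)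
  · refine (integrable_congr (splitₗ_snd_ae he f)).2 ?_
    exact measurePreserving_planeEquiv.integrable_comp_of_integrable (minusCoord.integrable_comp hf)

theorem fourier_eq_phase (f : Plane → ℂ) (w : Plane) : 𝓕 f w =
    ∫ v : Plane, phase (-1 * (2 * Real.pi) * (v.fst * w.fst + v.snd * w.snd)) * f v := by
  rw [Real.fourier_eq']
  congr 1; ext v
  rw [smul_eq_mul, phase, WithLp.prod_inner_apply]
  simp only [RCLike.inner_apply, conj_trivial]
  change _ = Complex.exp (Complex.I * ((_ * (v.ofLp.1 * w.ofLp.1 + v.ofLp.2 * w.ofLp.2) : ℝ))) * _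
  congr 2
  push_cast; ring

theorem fourierInv_eq_phase (f : Plane → ℂ) (w : Plane) : 𝓕⁻ f w =
    ∫ v : Plane, phase (1 * (2 * Real.pi) * (v.fst * w.fst + v.snd * w.snd)) * f v := by
  rw [Real.fourierInv_eq']
  congr 1; ext v
  rw [smul_eq_mul, phase, WithLp.prod_inner_apply]
  simp only [RCLike.inner_apply, conj_trivial]
  change _ = Complex.exp (Complex.I * ((_ * (v.ofLp.1 * w.ofLp.1 + v.ofLp.2 * w.ofLp.2) : ℝ))) * _
  congr 2
  push_cast; ring

theorem ae_eq_of_coord {e : Plane ≃ᵐ ℝ × ℝ} (he : MeasurePreserving e) {f : Signal}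
    {g : ℝ × ℝ → Quaternion ℝ}
    (h₁ : ((splitₗ he f).1 : Plane → ℂ) =ᵐ[volume] fun v => plusCoord (g (e v)))
    (h₂ : ((splitₗ he f).2 : Plane → ℂ) =ᵐ[volume] fun v => minusCoord (g (planeEquiv v))) :
    (f : ℝ × ℝ → Quaternion ℝ) =ᵐ[volume] g := by
  have k₁ := (he.symm e).quasiMeasurePreserving.ae_eq_comp ((splitₗ_fst_ae he f).symm.trans h₁)
  have k₂ := (measurePreserving_planeEquiv.symm _).quasiMeasurePreserving.ae_eq_comp
    ((splitₗ_snd_ae he f).symm.trans h₂)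
  filter_upwards [k₁, k₂] with z h1 h2
  simp only [Function.comp_apply, MeasurableEquiv.apply_symm_apply] at h1 h2
  exact eq_of_coord h1 h2

theorem qft_ae_eq (f : Signal) (hf : Integrable f) :
    (qft f : ℝ × ℝ → Quaternion ℝ) =ᵐ[volume] fourierIntegral (-1) f := by
  obtain ⟨i₁, i₂⟩ := integrable_splitₗ measurePreserving_planeEquivNeg hf
  refine ae_eq_of_coord measurePreserving_planeEquiv ?_ ?_
  · rw [split_qft]
    filter_upwards [fourier_toLp_ae_eq _ i₁] with w hw
    rw [hw, fourier_eq_phase, plusCoord_fourierIntegral _ hf,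
      ← measurePreserving_planeEquivNeg.integral_comp']
    refine integral_congr_ae ?_
    filter_upwards [splitₗ_fst_ae measurePreserving_planeEquivNeg f] with v hv
    rw [hv]; simp
  · rw [split_qft]
    filter_upwards [fourier_toLp_ae_eq _ i₂] with w hw
    rw [hw, fourier_eq_phase, minusCoord_fourierIntegral _ hf,
      ← measurePreserving_planeEquiv.integral_comp']
    refine integral_congr_ae ?_
    filter_upwards [splitₗ_snd_ae measurePreserving_planeEquivNeg f] with v hv
    rw [hv]; simp

theorem qft_symm_ae_eq (f : Signal) (hf : Integrable f) :
    (qft.symm f : ℝ × ℝ → Quaternion ℝ) =ᵐ[volume] fourierIntegral 1 f := by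
  obtain ⟨i₁, i₂⟩ := integrable_splitₗ measurePreserving_planeEquiv hf
  refine ae_eq_of_coord measurePreserving_planeEquivNeg ?_ ?_
  · rw [split_qft_symm]
    filter_upwards [fourierInv_toLp_ae_eq _ i₁] with w hw
    rw [hw, fourierInv_eq_phase, plusCoord_fourierIntegral _ hf,
      ← measurePreserving_planeEquiv.integral_comp']
    refine integral_congr_ae ?_
    filter_upwards [splitₗ_fst_ae measurePreserving_planeEquiv f] with v hv
    rw [hv]; simp
  · rw [split_qft_symm]
    filter_upwards [fourierInv_toLp_ae_eq _ i₂] with w hw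
    rw [hw, fourierInv_eq_phase, minusCoord_fourierIntegral _ hf,
      ← measurePreserving_planeEquiv.integral_comp']
    refine integral_congr_ae ?_
    filter_upwards [splitₗ_snd_ae measurePreserving_planeEquiv f] with v hv
    rw [hv]; simp

end QuaternionFourier

/-! ### Time and band limiting -/

section Cutoff

theorem memLp_indicator {S : Set (ℝ × ℝ)} (hS : MeasurableSet S) (f : Signal) :
    MemLp (S.indicator (f : ℝ × ℝ → Quaternion ℝ)) 2 :=
  (Lp.memLp f).indicator hS

/-- Multiplication by the indicator function of a measurable set, as a linear map. -/
def cutoffₗ {S : Set (ℝ × ℝ)} (hS : MeasurableSet S) : Signal →ₗ[ℝ] Signal where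
  toFun f := (memLp_indicator hS f).toLp (S.indicator (f : ℝ × ℝ → Quaternion ℝ))
  map_add' f g := by
    rw [← MemLp.toLp_add]
    refine MemLp.toLp_congr _ _ ?_
    filter_upwards [Lp.coeFn_add f g] with z hz
    simp only [Set.indicator, Pi.add_apply, hz]
    split_ifs <;> simp
  map_smul' c f := by
    rw [RingHom.id_apply, ← MemLp.toLp_const_smul]
    refine MemLp.toLp_congr _ _ ?_
    filter_upwards [Lp.coeFn_smul c f] with z hz
    simp only [Set.indicator, Pi.smul_apply, hz]
    split_ifs <;> simp

theorem cutoffₗ_ae {S : Set (ℝ × ℝ)} (hS : MeasurableSet S) (f : Signal) :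
    (cutoffₗ hS f : ℝ × ℝ → Quaternion ℝ) =ᵐ[volume]
      S.indicator (f : ℝ × ℝ → Quaternion ℝ) := by
  have h : cutoffₗ hS f =
    (memLp_indicator hS f).toLp (S.indicator (f : ℝ × ℝ → Quaternion ℝ)) := rfl
  rw [h]
  exact (memLp_indicator hS f).coeFn_toLp

/-- Multiplication by the indicator function of a measurable set. -/
def cutoff {S : Set (ℝ × ℝ)} (hS : MeasurableSet S) : Signal →L[ℝ] Signal :=
  (cutoffₗ hS).mkContinuous 1 fun f => by
    rw [one_mul, Lp.norm_def, Lp.norm_def, eLpNorm_congr_ae (cutoffₗ_ae hS f)]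
    exact ENNReal.toReal_mono (Lp.eLpNorm_ne_top f) (eLpNorm_indicator_le _)

variable {S : Set (ℝ × ℝ)} (hS : MeasurableSet S)

theorem cutoff_ae (f : Signal) :
    (cutoff hS f : ℝ × ℝ → Quaternion ℝ) =ᵐ[volume] S.indicator (f : ℝ × ℝ → Quaternion ℝ) :=
  cutoffₗ_ae hS f

theorem isOrthProj_cutoff : IsOrthProj (cutoff hS) where
  idem f := by
    refine Lp.ext ?_
    filter_upwards [cutoff_ae hS f, cutoff_ae hS (cutoff hS f)] with z h1 h2
    rw [h2, h1]
    by_cases hz : z ∈ S <;> simp [hz, h1]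
  symm f g := by
    rw [L2.inner_def, L2.inner_def]
    refine integral_congr_ae ?_
    filter_upwards [cutoff_ae hS f, cutoff_ae hS g] with z h1 h2
    rw [h2, h1]
    by_cases hz : z ∈ S <;> simp [hz]

/-- Cauchy–Schwarz on a set of finite measure. The constant does not depend on the frequency, which
later supplies the dominating function. -/
theorem integral_norm_le (hfin : volume S ≠ ⊤) (f : Signal) :
    IntegrableOn f S ∧ ∫ z in S, ‖f z‖ ≤ (volume S).toReal ^ (1 / 2 : ℝ) * ‖f‖ := by
  have : IsFiniteMeasure (volume.restrict S) := ⟨by simpa using hfin.lt_top⟩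
  have hm := (Lp.memLp f).restrict S
  have hi : IntegrableOn f S := hm.integrable (by norm_num)
  refine ⟨hi, ?_⟩
  have h1 := eLpNorm_le_eLpNorm_mul_rpow_measure_univ (p := 1) (q := 2) (by norm_num)
    hm.aestronglyMeasurable
  have h2 : eLpNorm f 2 (volume.restrict S) ≤ eLpNorm f 2 volume :=
    eLpNorm_mono_measure _ Measure.restrict_le_self
  rw [integral_norm_eq_lintegral_enorm hi.1, ← eLpNorm_one_eq_lintegral_enorm, mul_comm,
    Lp.norm_def, ENNReal.toReal_rpow, ← ENNReal.toReal_mul]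
  refine ENNReal.toReal_mono (ENNReal.mul_ne_top (Lp.eLpNorm_ne_top f)
    (ENNReal.rpow_ne_top_of_nonneg (by norm_num) hfin)) (h1.trans ?_)
  rw [Measure.restrict_apply_univ]
  norm_num
  gcongr

theorem integrable_cutoff (hfin : volume S ≠ ⊤) (f : Signal) :
    Integrable (cutoff hS f : ℝ × ℝ → Quaternion ℝ) :=
  (integrable_congr (cutoff_ae hS f)).2
    ((integrable_indicator_iff hS).2 (integral_norm_le hfin f).1)

theorem fourierIntegral_cutoff (s : ℝ) (f : Signal) (w : ℝ × ℝ) :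
    fourierIntegral s (cutoff hS f) w =
      ∫ z in S, complexI (phase (s * (2 * Real.pi) * (z.1 * w.1))) * f z *
        complexJ (phase (s * (2 * Real.pi) * (z.2 * w.2))) := by
  rw [fourierIntegral, ← integral_indicator hS]
  refine integral_congr_ae ?_
  filter_upwards [cutoff_ae hS f] with z hz
  rw [hz]
  by_cases h : z ∈ S <;> simp [h]

/-- The value at `w` of the Fourier transform of a signal cut off to a set of finite measure. -/
def fourierEval (hfin : volume S ≠ ⊤) (w : ℝ × ℝ) : Signal →L[ℝ] Quaternion ℝ :=
  LinearMap.mkContinuous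
    { toFun := fun f => ∫ z in S, complexI (phase (-1 * (2 * Real.pi) * (z.1 * w.1))) * f z *
        complexJ (phase (-1 * (2 * Real.pi) * (z.2 * w.2)))
      map_add' := fun f g => by
        rw [← integral_add (integrable_phase_mul (integral_norm_le hfin f).1 (by fun_prop)
          (by fun_prop)) (integrable_phase_mul (integral_norm_le hfin g).1 (by fun_prop)
          (by fun_prop))]
        refine integral_congr_ae ?_
        filter_upwards [ae_restrict_of_ae (Lp.coeFn_add f g)] with z hz
        rw [hz, Pi.add_apply, mul_add, add_mul]
      map_smul' := fun c f => by
        rw [RingHom.id_apply, ← integral_smul]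
        refine integral_congr_ae ?_
        filter_upwards [ae_restrict_of_ae (Lp.coeFn_smul c f)] with z hz
        rw [hz, Pi.smul_apply, mul_smul_comm, smul_mul_assoc] }
    ((volume S).toReal ^ (1 / 2 : ℝ)) fun f => by
      refine (norm_integral_le_integral_norm _).trans ?_
      simp_rw [norm_phase_mul]
      exact (integral_norm_le hfin f).2

theorem norm_fourierEval_le (hfin : volume S ≠ ⊤) (w : ℝ × ℝ) (f : Signal) :
    ‖fourierEval hfin w f‖ ≤ (volume S).toReal ^ (1 / 2 : ℝ) * ‖f‖ := by
  refine (norm_integral_le_integral_norm _).trans ?_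
  simp_rw [norm_phase_mul]
  exact (integral_norm_le hfin f).2

theorem qft_cutoff_ae (hfin : volume S ≠ ⊤) (f : Signal) :
    (qft (cutoff hS f) : ℝ × ℝ → Quaternion ℝ) =ᵐ[volume] fun w => fourierEval hfin w f := by
  filter_upwards [qft_ae_eq _ (integrable_cutoff hS hfin f)] with w hw
  rw [hw, fourierIntegral_cutoff]
  rfl

open scoped RealInnerProductSpace in
-- The finitely many coordinates of T z are inner products of z with fixed vectors, so weak
-- convergence suffices.
theorem tendsto_apply_of_weak {H F : Type*} [NormedAddCommGroup H] [InnerProductSpace ℝ H]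
    [CompleteSpace H] [NormedAddCommGroup F] [InnerProductSpace ℝ F] [FiniteDimensional ℝ F]
    (T : H →L[ℝ] F) {u : ℕ → H} {x : H}
    (h : ∀ y, Tendsto (fun n => ⟪u n, y⟫) atTop (𝓝 ⟪x, y⟫)) :
    Tendsto (fun n => T (u n)) atTop (𝓝 (T x)) := by
  have : CompleteSpace F := FiniteDimensional.complete ℝ F
  have key : ∀ z, T z = ∑ i, ⟪z, T.adjoint (stdOrthonormalBasis ℝ F i)⟫ •
      stdOrthonormalBasis ℝ F i := fun z => by
    conv_lhs => rw [← (stdOrthonormalBasis ℝ F).sum_repr' (T z)]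
    refine Finset.sum_congr rfl fun i _ => ?_
    rw [ContinuousLinearMap.adjoint_inner_right, real_inner_comm]
  rw [key x]
  simp_rw [key (u _)]
  exact tendsto_finsetSum _ fun i _ => (h _).smul_const _

variable {R : Set (ℝ × ℝ)} (hR : MeasurableSet R)

/-- Time limiting to `S`, Fourier transform, and band limiting to `R`. -/
def limitedFourier : Signal →L[ℝ] Signal :=
  cutoff hR ∘L (qft.toContinuousLinearEquiv : Signal →L[ℝ] Signal) ∘L cutoff hS

theorem limitedFourier_apply (f : Signal) :
    limitedFourier hS hR f = cutoff hR (qft (cutoff hS f)) := rfl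

theorem limitedFourier_ae (hfin : volume S ≠ ⊤) (f : Signal) :
    (limitedFourier hS hR f : ℝ × ℝ → Quaternion ℝ) =ᵐ[volume]
      R.indicator fun w => fourierEval hfin w f := by
  filter_upwards [cutoff_ae hR (qft (cutoff hS f)), qft_cutoff_ae hS hfin f] with w h1 h2
  rw [limitedFourier_apply, h1]
  by_cases hw : w ∈ R <;> simp [hw, h2]

open scoped RealInnerProductSpace in
-- Weak convergence gives pointwise convergence of the transforms, since each evaluation has finite
-- rank. They are uniformly bounded by a multiple of ‖u n - x‖ ≤ 1 + ‖x‖, and R has finite measure,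
-- so dominated convergence gives convergence in norm.
theorem tendsto_limitedFourier_of_weak (hSfin : volume S ≠ ⊤) (hRfin : volume R ≠ ⊤)
    (u : ℕ → Signal) (x : Signal) (hu : ∀ n, ‖u n‖ ≤ 1)
    (hw : ∀ y, Tendsto (fun n => ⟪u n, y⟫) atTop (𝓝 ⟪x, y⟫)) :
    Tendsto (fun n => limitedFourier hS hR (u n)) atTop (𝓝 (limitedFourier hS hR x)) := by
  rw [tendsto_iff_norm_sub_tendsto_zero]
  set M := (volume S).toReal ^ (1 / 2 : ℝ) * (1 + ‖x‖)
  have hae : ∀ᵐ w, ∀ n, (limitedFourier hS hR (u n - x) : ℝ × ℝ → Quaternion ℝ) w =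
      R.indicator (fun w => fourierEval hSfin w (u n - x)) w :=
    ae_all_iff.2 fun n => limitedFourier_ae hS hR hSfin (u n - x)
  have key : Tendsto (fun n => ∫ w, ‖(limitedFourier hS hR (u n - x) : ℝ × ℝ → Quaternion ℝ) w‖ ^ 2)
      atTop (𝓝 (∫ _ : ℝ × ℝ, (0 : ℝ))) := by
    refine tendsto_integral_of_dominated_convergence (R.indicator fun _ => M ^ 2) ?_ ?_ ?_ ?_
    · exact fun n => (Lp.aestronglyMeasurable _).norm.pow 2
    · exact (integrable_indicator_iff hR).2 (integrableOn_const hRfin)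
    · intro n
      filter_upwards [hae] with w hw
      rw [hw n]
      by_cases h : w ∈ R
      · have h1 : ‖fourierEval hSfin w (u n - x)‖ ≤ M := by
          refine (norm_fourierEval_le hSfin w _).trans ?_
          refine mul_le_mul_of_nonneg_left ?_ (by positivity)
          exact (norm_sub_le _ _).trans (add_le_add_left (hu n) _)
        rw [Real.norm_of_nonneg (by positivity)]
        simp only [h, Set.indicator_of_mem]
        gcongr
      · simp [h]
    · filter_upwards [hae] with w hw'
      simp_rw [hw']
      by_cases h : w ∈ R
      · simp only [h, Set.indicator_of_mem, map_sub]
        have := (tendsto_apply_of_weak (fourierEval hSfin w) hw).sub_const (fourierEval hSfin w x)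
        rw [sub_self] at this
        simpa using this.norm.pow 2
      · simp [h]
  rw [integral_zero] at key
  have h2 : (fun n => ‖limitedFourier hS hR (u n) - limitedFourier hS hR x‖) =
      fun n => √(∫ w, ‖(limitedFourier hS hR (u n - x) : ℝ × ℝ → Quaternion ℝ) w‖ ^ 2) := by
    ext n
    rw [← norm_sq_eq_integral, Real.sqrt_sq (norm_nonneg _), map_sub]
  rw [h2]
  simpa using key.sqrt

open FourierTransform in
-- The transform has a continuous representative, so vanishing almost everywhere on O becomes
-- vanishing on O; analyticity spreads this to the plane, and Plancherel returns to g.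
theorem fourier_Lp_eq_zero (g : Lp (α := Plane) ℂ 2) (hg : Integrable g) {C : ℝ}
    (hC : ∀ᵐ v, g v ≠ 0 → ‖v‖ ≤ C) {O : Set Plane} (hO : IsOpen O) (hne : O.Nonempty)
    (hz : ∀ᵐ v, v ∈ O → (𝓕 g : Lp (α := Plane) ℂ 2) v = 0) : g = 0 := by
  have h1 := fourier_toLp_ae_eq g hg
  have h2 : Set.EqOn (𝓕 (g : Plane → ℂ)) 0 O := by
    refine Measure.eqOn_open_of_ae_eq (μ := (volume : Measure Plane)) ?_ hO
      (continuous_fourier_of_integrable hg).continuousOn continuousOn_const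
    rw [Filter.EventuallyEq, ae_restrict_iff' hO.measurableSet]
    filter_upwards [h1, hz] with v h3 h4 hv
    rw [← h3, h4 hv]; rfl
  have h3 := fourier_eq_zero_of_bounded_support hg hC hO hne fun w hw => h2 hw
  have h4 : 𝓕 g = 0 := by
    rw [Lp.eq_zero_iff_ae_eq_zero]
    filter_upwards [h1] with v h5
    rw [h5, h3]; rfl
  have h5 := Lp.norm_fourier_eq g
  rwa [h4, norm_zero, eq_comm, norm_eq_zero] at h5

theorem norm_plane_le {v : Plane} {τ : ℝ} (h₁ : |v.fst| ≤ τ) (h₂ : |v.snd| ≤ τ) :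
    ‖v‖ ≤ 2 * τ := by
  have hτ := (abs_nonneg _).trans h₁
  rw [← sq_le_sq₀ (norm_nonneg _) (by positivity), WithLp.prod_norm_sq_eq_of_L2,
    Real.norm_eq_abs, Real.norm_eq_abs]
  have := pow_le_pow_left₀ (abs_nonneg _) h₁ 2
  have := pow_le_pow_left₀ (abs_nonneg _) h₂ 2
  nlinarith [sq_nonneg τ]

theorem mem_square_iff {r : ℝ} {z : ℝ × ℝ} : z ∈ square r ↔ |z.1| ≤ r ∧ |z.2| ≤ r := by
  rw [square, Set.mem_prod, Set.mem_Icc, Set.mem_Icc, abs_le, abs_le]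

/-- The rectangle `[-a, a] × [-b, b]`. -/
def rect (a b : ℝ) : Set (ℝ × ℝ) := Set.Icc (-a) a ×ˢ Set.Icc (-b) b

theorem measurableSet_rect (a b : ℝ) : MeasurableSet (rect a b) :=
  measurableSet_Icc.prod measurableSet_Icc

theorem measurableSet_square (r : ℝ) : MeasurableSet (square r) :=
  measurableSet_Icc.prod measurableSet_Icc

theorem volume_rect_ne_top (a b : ℝ) : volume (rect a b) ≠ ⊤ :=
  (isCompact_Icc.prod isCompact_Icc).measure_ne_top

theorem volume_square_ne_top (r : ℝ) : volume (square r) ≠ ⊤ :=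
  (isCompact_Icc.prod isCompact_Icc).measure_ne_top

theorem continuous_planeEquiv : Continuous planeEquiv :=
  WithLp.prod_continuous_ofLp 2 ℝ ℝ

/-- A signal limited to a square whose Fourier transform vanishes on a nonempty open set is
zero. -/
theorem eq_zero_of_qft_eq_zero {τ : ℝ} {f : Signal} (hf : cutoff (measurableSet_square τ) f = f)
    {O : Set (ℝ × ℝ)} (hO : IsOpen O) (hne : O.Nonempty)
    (hz : ∀ᵐ w, w ∈ O → (qft f : ℝ × ℝ → Quaternion ℝ) w = 0) : f = 0 := by
  have hint : Integrable f := by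
    rw [← hf]; exact integrable_cutoff _ (volume_square_ne_top τ) f
  have hsupp : ∀ᵐ z, f z ≠ 0 → |z.1| ≤ τ ∧ |z.2| ≤ τ := by
    have h1 := cutoff_ae (measurableSet_square τ) f
    rw [hf] at h1
    filter_upwards [h1] with z hz h0
    rw [← mem_square_iff]
    by_contra hn
    exact h0 (by rw [hz]; simp [hn])
  obtain ⟨i₁, i₂⟩ := integrable_splitₗ measurePreserving_planeEquivNeg hint
  have hO' : IsOpen (planeEquiv ⁻¹' O) := hO.preimage continuous_planeEquiv
  have hne' : (planeEquiv ⁻¹' O).Nonempty := hne.preimage planeEquiv.surjective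
  have hq := split_qft f
  have hz' := measurePreserving_planeEquiv.quasiMeasurePreserving.ae hz
  have e₁ : (splitₗ measurePreserving_planeEquivNeg f).1 = 0 := by
    refine fourier_Lp_eq_zero _ i₁ (C := 2 * τ) ?_ hO' hne' ?_
    · filter_upwards [splitₗ_fst_ae measurePreserving_planeEquivNeg f,
        measurePreserving_planeEquivNeg.quasiMeasurePreserving.ae hsupp] with v h1 h2 h3
      rw [h1] at h3
      have h4 := h2 fun h => h3 (by rw [h, map_zero])
      simp only [planeEquivNeg_apply, abs_neg] at h4
      exact norm_plane_le h4.1 h4.2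
    · have := splitₗ_fst_ae measurePreserving_planeEquiv (qft f)
      rw [hq] at this
      filter_upwards [this, hz'] with v h1 h2 h3
      rw [h1, h2 h3, map_zero]
  have e₂ : (splitₗ measurePreserving_planeEquivNeg f).2 = 0 := by
    refine fourier_Lp_eq_zero _ i₂ (C := 2 * τ) ?_ hO' hne' ?_
    · filter_upwards [splitₗ_snd_ae measurePreserving_planeEquivNeg f,
        measurePreserving_planeEquiv.quasiMeasurePreserving.ae hsupp] with v h1 h2 h3
      rw [h1] at h3
      have h4 := h2 fun h => h3 (by rw [h, map_zero])
      exact norm_plane_le h4.1 h4.2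
    · have := splitₗ_snd_ae measurePreserving_planeEquiv (qft f)
      rw [hq] at this
      filter_upwards [this, hz'] with v h1 h2 h3
      rw [h1, h2 h3, map_zero]
  have := norm_sq_splitₗ measurePreserving_planeEquivNeg f
  simpa [e₁, e₂] using this

end Cutoff

/-! ### The low-pass kernel -/

section LowPass

theorem integral_phase (t : ℝ) {ν : ℝ} (hν : 0 ≤ ν) :
    ∫ s in Set.Icc (-ν) ν, phase (2 * Real.pi * (s * t)) =
      (lowPassKernel (2 * Real.pi * ν) t : ℂ) := by
  rw [integral_Icc_eq_integral_Ioc, ← intervalIntegral.integral_of_le (by linarith)]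
  unfold lowPassKernel
  have hpi := Real.pi_ne_zero
  rcases eq_or_ne t 0 with rfl | ht
  · simp only [mul_zero, phase_zero, intervalIntegral.integral_const, Real.sinc_zero, mul_one]
    rw [Complex.real_smul, mul_one]
    congr 1
    field_simp
    ring
  · rcases eq_or_ne ν 0 with rfl | hν0
    · simp
    have hc : (2 * Real.pi * t : ℂ) * Complex.I ≠ 0 := by
      simp [ht, hpi]
    have h1 : ∀ s : ℝ, phase (2 * Real.pi * (s * t)) =
        Complex.exp ((2 * Real.pi * t : ℂ) * Complex.I * s) := fun s => by
      rw [phase]; push_cast; ring_nf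
    simp_rw [h1]
    rw [integral_exp_mul_complex hc, Real.sinc_of_ne_zero (by positivity)]
    have h2 : (2 * Real.pi * t : ℂ) * Complex.I * (ν : ℝ) =
        ((2 * Real.pi * ν * t : ℝ) : ℂ) * Complex.I := by push_cast; ring
    have h3 : (2 * Real.pi * t : ℂ) * Complex.I * ((-ν : ℝ) : ℂ) =
        -((2 * Real.pi * ν * t : ℝ) : ℂ) * Complex.I := by push_cast; ring
    have h4 : Complex.exp (((2 * Real.pi * ν * t : ℝ) : ℂ) * Complex.I) -
        Complex.exp (-((2 * Real.pi * ν * t : ℝ) : ℂ) * Complex.I) =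
        2 * Complex.I * (Real.sin (2 * Real.pi * ν * t) : ℂ) := by
      rw [Complex.ofReal_sin, Complex.sin]
      ring_nf
      rw [Complex.I_sq]
      ring
    rw [h2, h3, h4]
    push_cast
    have hpi' : (Real.pi : ℂ) ≠ 0 := by exact_mod_cast hpi
    have ht' : (t : ℂ) ≠ 0 := by exact_mod_cast ht
    have hν' : (ν : ℂ) ≠ 0 := by exact_mod_cast hν0
    field_simp

theorem complexI_ofReal_mul (a : ℝ) (q : Quaternion ℝ) : complexI (a : ℂ) * q = a • q := by
  apply Quaternion.ext <;> simp

theorem mul_complexJ_ofReal (a : ℝ) (q : Quaternion ℝ) : q * complexJ (a : ℂ) = a • q := by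
  apply Quaternion.ext <;> simp [mul_comm]

theorem integrableOn_of_continuous_Icc {F : Type*} [NormedAddCommGroup F] {f : ℝ → F}
    (hf : Continuous f) (a b : ℝ) : IntegrableOn f (Set.Icc a b) :=
  hf.continuousOn.integrableOn_compact isCompact_Icc

/-- The two phases stand on opposite sides of q, so Fubini integrates them separately. Each integral
is real by symmetry of the interval and therefore commutes with q. -/
theorem integral_rect_phase {ν₁ ν₂ : ℝ} (h₁ : 0 ≤ ν₁) (h₂ : 0 ≤ ν₂) (s t : ℝ)
    (q : Quaternion ℝ) :
    ∫ r in rect ν₁ ν₂, complexI (phase (2 * Real.pi * (r.1 * s))) * q *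
      complexJ (phase (2 * Real.pi * (r.2 * t))) =
      (lowPassKernel (2 * Real.pi * ν₁) s * lowPassKernel (2 * Real.pi * ν₂) t) • q := by
  have c1 : Continuous fun r : ℝ => complexI (phase (2 * Real.pi * (r * s))) := by fun_prop
  have c2 : Continuous fun r : ℝ => complexJ (phase (2 * Real.pi * (r * t))) := by fun_prop
  have i1 : ∫ r in Set.Icc (-ν₁) ν₁, complexI (phase (2 * Real.pi * (r * s))) =
      complexI (lowPassKernel (2 * Real.pi * ν₁) s : ℂ) := by
    rw [← integral_phase s h₁]
    exact complexICLM.integral_comp_comm (integrableOn_of_continuous_Icc (by fun_prop) _ _)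
  have i2 : ∫ r in Set.Icc (-ν₂) ν₂, complexJ (phase (2 * Real.pi * (r * t))) =
      complexJ (lowPassKernel (2 * Real.pi * ν₂) t : ℂ) := by
    rw [← integral_phase t h₂]
    exact complexJCLM.integral_comp_comm (integrableOn_of_continuous_Icc (by fun_prop) _ _)
  have hint : IntegrableOn (fun r : ℝ × ℝ => complexI (phase (2 * Real.pi * (r.1 * s))) * q *
      complexJ (phase (2 * Real.pi * (r.2 * t)))) (rect ν₁ ν₂) (volume.prod volume) :=
    (by fun_prop : Continuous _).continuousOn.integrableOn_compact
      (isCompact_Icc.prod isCompact_Icc)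
  rw [Measure.volume_eq_prod, rect, setIntegral_prod _ hint]
  have i3 : ∀ x : ℝ, ∫ y in Set.Icc (-ν₂) ν₂, complexI (phase (2 * Real.pi * (x * s))) * q *
      complexJ (phase (2 * Real.pi * (y * t))) =
      complexI (phase (2 * Real.pi * (x * s))) *
        (q * complexJ (lowPassKernel (2 * Real.pi * ν₂) t : ℂ)) := fun x => by
    rw [integral_const_mul_of_integrable (integrableOn_of_continuous_Icc c2 _ _), i2, mul_assoc]
  simp_rw [i3]
  rw [integral_mul_const_of_integrable (integrableOn_of_continuous_Icc c1 _ _), i1,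
    mul_complexJ_ofReal, complexI_ofReal_mul, smul_smul]

variable (ν₁ ν₂ : ℝ)

/-- The projection onto the signals whose Fourier transform is supported in
`[-ν₁, ν₁] × [-ν₂, ν₂]`. -/
def bandLimit : Signal →L[ℝ] Signal :=
  (qft.symm.toContinuousLinearEquiv : Signal →L[ℝ] Signal) ∘L cutoff (measurableSet_rect ν₁ ν₂) ∘L
    (qft.toContinuousLinearEquiv : Signal →L[ℝ] Signal)

theorem bandLimit_apply (f : Signal) :
    bandLimit ν₁ ν₂ f = qft.symm (cutoff (measurableSet_rect ν₁ ν₂) (qft f)) := rfl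

theorem norm_bandLimit (f : Signal) :
    ‖bandLimit ν₁ ν₂ f‖ = ‖cutoff (measurableSet_rect ν₁ ν₂) (qft f)‖ := by
  rw [bandLimit_apply, LinearIsometryEquiv.norm_map]

theorem isOrthProj_bandLimit : IsOrthProj (bandLimit ν₁ ν₂) where
  idem f := by
    simp only [bandLimit_apply, LinearIsometryEquiv.apply_symm_apply, (isOrthProj_cutoff _).idem]
  symm f g := by
    rw [bandLimit_apply, bandLimit_apply, ← LinearIsometryEquiv.inner_map_map qft,
      LinearIsometryEquiv.apply_symm_apply, (isOrthProj_cutoff _).symm,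
      ← LinearIsometryEquiv.inner_map_map qft f, LinearIsometryEquiv.apply_symm_apply]

variable {ν₁ ν₂}

/-- Time limiting followed by band limiting is the integral operator with the low-pass kernel. -/
theorem bandLimit_cutoff_ae (h₁ : 0 ≤ ν₁) (h₂ : 0 ≤ ν₂) {S : Set (ℝ × ℝ)} (hS : MeasurableSet S)
    (hfin : volume S ≠ ⊤) (f : Signal) :
    (bandLimit ν₁ ν₂ (cutoff hS f) : ℝ × ℝ → Quaternion ℝ) =ᵐ[volume] fun w =>
      ∫ z in S, (lowPassKernel (2 * Real.pi * ν₁) (z.1 - w.1) *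
        lowPassKernel (2 * Real.pi * ν₂) (z.2 - w.2)) • f z := by
  have hR := measurableSet_rect ν₁ ν₂
  have hRf := volume_rect_ne_top ν₁ ν₂
  have : IsFiniteMeasure (volume.restrict S) := ⟨by simpa using hfin.lt_top⟩
  have : IsFiniteMeasure (volume.restrict (rect ν₁ ν₂)) := ⟨by simpa using hRf.lt_top⟩
  filter_upwards [qft_symm_ae_eq _ (integrable_cutoff hR hRf (qft (cutoff hS f)))] with w hw
  rw [bandLimit_apply, hw, fourierIntegral_cutoff]
  have hlow : ∀ ω t, lowPassKernel ω (-t) = lowPassKernel ω t := fun ω t => by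
    simp [lowPassKernel, Real.sinc_neg]
  -- Phases of the forward and inverse transforms meet on the same side of f z, within one
  -- commutative copy of ℂ, and merge.
  have key : ∀ r z : ℝ × ℝ, complexI (phase (1 * (2 * Real.pi) * (r.1 * w.1))) *
      (complexI (phase (-1 * (2 * Real.pi) * (z.1 * r.1))) * f z *
        complexJ (phase (-1 * (2 * Real.pi) * (z.2 * r.2)))) *
        complexJ (phase (1 * (2 * Real.pi) * (r.2 * w.2))) =
      complexI (phase (2 * Real.pi * (r.1 * (w.1 - z.1)))) * f z *
        complexJ (phase (2 * Real.pi * (r.2 * (w.2 - z.2)))) := fun r z => by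
    rw [show 2 * Real.pi * (r.1 * (w.1 - z.1)) = 1 * (2 * Real.pi) * (r.1 * w.1) +
      -1 * (2 * Real.pi) * (z.1 * r.1) by ring, show 2 * Real.pi * (r.2 * (w.2 - z.2)) =
      -1 * (2 * Real.pi) * (z.2 * r.2) + 1 * (2 * Real.pi) * (r.2 * w.2) by ring,
      phase_add, phase_add, complexI_mul, complexJ_mul]
    simp only [mul_assoc]
  have step : ∀ r : ℝ × ℝ, complexI (phase (1 * (2 * Real.pi) * (r.1 * w.1))) *
      fourierEval hfin r f * complexJ (phase (1 * (2 * Real.pi) * (r.2 * w.2))) =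
      ∫ z in S, complexI (phase (2 * Real.pi * (r.1 * (w.1 - z.1)))) * f z *
        complexJ (phase (2 * Real.pi * (r.2 * (w.2 - z.2)))) := fun r => by
    have hi := integrable_phase_mul (integral_norm_le hfin f).1
      (a := fun z => -1 * (2 * Real.pi) * (z.1 * r.1))
      (b := fun z => -1 * (2 * Real.pi) * (z.2 * r.2)) (by fun_prop) (by fun_prop)
    simp_rw [← key r]
    rw [integral_mul_const_of_integrable (hi.const_mul _), integral_const_mul_of_integrable hi]
    rfl
  have e1 : ∫ r in rect ν₁ ν₂, complexI (phase (1 * (2 * Real.pi) * (r.1 * w.1))) *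
      qft (cutoff hS f) r * complexJ (phase (1 * (2 * Real.pi) * (r.2 * w.2))) =
      ∫ r in rect ν₁ ν₂, ∫ z in S, complexI (phase (2 * Real.pi * (r.1 * (w.1 - z.1)))) * f z *
        complexJ (phase (2 * Real.pi * (r.2 * (w.2 - z.2)))) := by
    refine integral_congr_ae ?_
    filter_upwards [ae_restrict_of_ae (qft_cutoff_ae hS hfin f)] with r hr
    rw [hr, step]
  rw [e1, integral_integral_swap]
  · refine integral_congr_ae (Eventually.of_forall fun z => ?_)
    simp only
    rw [integral_rect_phase h₁ h₂, ← hlow _ (w.1 - z.1), ← hlow _ (w.2 - z.2), neg_sub, neg_sub]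
  -- The swap is legitimate since the phases have norm 1, f is integrable on S and the rectangle has
  -- finite measure.
  · have hf2 : Integrable (fun p : (ℝ × ℝ) × (ℝ × ℝ) => f p.2)
        ((volume.restrict (rect ν₁ ν₂)).prod (volume.restrict S)) :=
      (integral_norm_le hfin f).1.comp_snd _
    refine hf2.mono ?_ (Eventually.of_forall fun p => by
      simp only [Function.uncurry]; rw [norm_phase_mul])
    simp only [Function.uncurry_def]
    exact ((by fun_prop : Continuous fun p : (ℝ × ℝ) × (ℝ × ℝ) =>
      complexI (phase (2 * Real.pi * (p.1.1 * (w.1 - p.2.1))))).aestronglyMeasurable.mul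
      hf2.1).mul (by fun_prop : Continuous fun p : (ℝ × ℝ) × (ℝ × ℝ) =>
      complexJ (phase (2 * Real.pi * (p.1.2 * (w.2 - p.2.2))))).aestronglyMeasurable

end LowPass

/-! ### The linear canonical transform in terms of the Fourier transform -/

section Canonical

/-- The factor of the canonical kernel that depends only on the frequency variable. -/
def outerFactor (A : Matrix (Fin 2) (Fin 2) ℝ) (u : ℝ) : ℂ :=
  1 / (Complex.I * (2 * Real.pi * A 0 1 : ℝ)) ^ (1 / 2 : ℂ) *
    phase (A 1 1 / (2 * A 0 1) * u ^ 2)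

theorem continuous_outerFactor (A : Matrix (Fin 2) (Fin 2) ℝ) : Continuous (outerFactor A) := by
  unfold outerFactor; fun_prop

theorem norm_outerFactor {A : Matrix (Fin 2) (Fin 2) ℝ} (hb : 0 < A 0 1) (u : ℝ) :
    ‖outerFactor A u‖ = (√(2 * Real.pi * A 0 1))⁻¹ := by
  have hp : 0 < 2 * Real.pi * A 0 1 := by positivity
  have h0 : Complex.I * (2 * Real.pi * A 0 1 : ℝ) ≠ 0 :=
    mul_ne_zero Complex.I_ne_zero (by exact_mod_cast hp.ne')
  rw [outerFactor, norm_mul, norm_phase, mul_one, norm_div, norm_one, one_div]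
  congr 1
  rw [Complex.norm_cpow_of_ne_zero h0]
  have him : (1 / 2 : ℂ).im = 0 := by norm_num
  have hre : (1 / 2 : ℂ).re = 1 / 2 := by norm_num
  rw [him, hre, mul_zero, Real.exp_zero, div_one, norm_mul, Complex.norm_I, one_mul,
    Complex.norm_real, Real.norm_of_nonneg hp.le, Real.sqrt_eq_rpow]

/-- The quadratic exponent separates into a part in u, the Fourier phase at frequency u/(2πb), and
the chirp in x. -/
theorem lctKernel_eq {A : Matrix (Fin 2) (Fin 2) ℝ} (hb : 0 < A 0 1) (x u : ℝ) :
    lctKernel A x u = outerFactor A u *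
      phase (-1 * (2 * Real.pi) * (x * ((2 * Real.pi * A 0 1)⁻¹ * u))) *
      phase (A 0 0 / (2 * A 0 1) * x ^ 2) := by
  have e : Complex.exp (Complex.I * (A 0 0 / (2 * A 0 1) * x ^ 2 - 1 / A 0 1 * (x * u) +
      A 1 1 / (2 * A 0 1) * u ^ 2 : ℝ)) = phase (A 1 1 / (2 * A 0 1) * u ^ 2) *
      phase (-1 * (2 * Real.pi) * (x * ((2 * Real.pi * A 0 1)⁻¹ * u))) *
      phase (A 0 0 / (2 * A 0 1) * x ^ 2) := by
    rw [← phase_add, ← phase_add, phase]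
    congr 3
    have := Real.pi_ne_zero
    field_simp
    ring
  rw [lctKernel, outerFactor, e]
  ring

variable (A₁ A₂ : Matrix (Fin 2) (Fin 2) ℝ)

/-- The scaling of frequencies relating the canonical and the Fourier transform. -/
def dilation (w : ℝ × ℝ) : ℝ × ℝ :=
  ((2 * Real.pi * A₁ 0 1)⁻¹ * w.1, (2 * Real.pi * A₂ 0 1)⁻¹ * w.2)

/-- The passage from the Fourier transform of the chirped signal to the canonical transform. -/
def outer (G : ℝ × ℝ → Quaternion ℝ) (w : ℝ × ℝ) : Quaternion ℝ :=
  complexI (outerFactor A₁ w.1) * G (dilation A₁ A₂ w) * complexJ (outerFactor A₂ w.2)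

theorem chirped_eq_phase (f : ℝ × ℝ → Quaternion ℝ) (z : ℝ × ℝ) : chirped A₁ A₂ f z =
    complexI (phase (A₁ 0 0 / (2 * A₁ 0 1) * z.1 ^ 2)) * f z *
      complexJ (phase (A₂ 0 0 / (2 * A₂ 0 1) * z.2 ^ 2)) := rfl

theorem norm_chirped (f : ℝ × ℝ → Quaternion ℝ) (z : ℝ × ℝ) :
    ‖chirped A₁ A₂ f z‖ = ‖f z‖ := by
  rw [chirped_eq_phase, norm_phase_mul]

theorem memLp_chirped {f : ℝ × ℝ → Quaternion ℝ} {p : ENNReal} (hf : MemLp f p) :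
    MemLp (chirped A₁ A₂ f) p := by
  refine hf.mono ?_ (Eventually.of_forall fun z => (norm_chirped A₁ A₂ f z).le)
  exact ((by fun_prop : Continuous fun z : ℝ × ℝ =>
    complexI (phase (A₁ 0 0 / (2 * A₁ 0 1) * z.1 ^ 2))).aestronglyMeasurable.mul hf.1).mul
    (by fun_prop : Continuous fun z : ℝ × ℝ =>
      complexJ (phase (A₂ 0 0 / (2 * A₂ 0 1) * z.2 ^ 2))).aestronglyMeasurable

theorem chirped_indicator (S : Set (ℝ × ℝ)) (f : ℝ × ℝ → Quaternion ℝ) :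
    chirped A₁ A₂ (S.indicator f) = S.indicator (chirped A₁ A₂ f) := by
  ext1 z
  by_cases hz : z ∈ S <;> simp [chirped_eq_phase, hz]

/-- Every signal is the chirped version of a signal. -/
theorem exists_chirped_eq {g : ℝ × ℝ → Quaternion ℝ} (hg : MemLp g 2) :
    ∃ f, MemLp f 2 volume ∧ chirped A₁ A₂ f = g := by
  refine ⟨fun z => complexI (phase (-(A₁ 0 0 / (2 * A₁ 0 1) * z.1 ^ 2))) * g z *
      complexJ (phase (-(A₂ 0 0 / (2 * A₂ 0 1) * z.2 ^ 2))), ?_, ?_⟩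
  · refine hg.mono ?_ (Eventually.of_forall fun z => by rw [norm_phase_mul])
    exact ((by fun_prop : Continuous fun z : ℝ × ℝ =>
      complexI (phase (-(A₁ 0 0 / (2 * A₁ 0 1) * z.1 ^ 2)))).aestronglyMeasurable.mul hg.1).mul
      (by fun_prop : Continuous fun z : ℝ × ℝ =>
        complexJ (phase (-(A₂ 0 0 / (2 * A₂ 0 1) * z.2 ^ 2)))).aestronglyMeasurable
  · ext1 z
    rw [chirped_eq_phase]
    simp only [← mul_assoc]
    rw [← complexI_mul, mul_assoc, ← complexJ_mul, ← phase_add, ← phase_add]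
    simp

variable {A₁ A₂}

theorem measurable_dilation : Measurable (dilation A₁ A₂) := by
  unfold dilation; fun_prop

theorem map_dilation (hb₁ : 0 < A₁ 0 1) (hb₂ : 0 < A₂ 0 1) :
    Measure.map (dilation A₁ A₂) volume =
      ENNReal.ofReal (2 * Real.pi * A₁ 0 1 * (2 * Real.pi * A₂ 0 1)) • volume := by
  have h1 : (0 : ℝ) < 2 * Real.pi * A₁ 0 1 := by positivity
  have h2 : (0 : ℝ) < 2 * Real.pi * A₂ 0 1 := by positivity
  have e : dilation A₁ A₂ = Prod.map (fun x => (2 * Real.pi * A₁ 0 1)⁻¹ * x)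
      (fun x => (2 * Real.pi * A₂ 0 1)⁻¹ * x) := rfl
  rw [e, Measure.volume_eq_prod, ← Measure.map_prod_map _ _ (by fun_prop) (by fun_prop),
    Real.map_volume_mul_left (inv_ne_zero h1.ne'), Real.map_volume_mul_left (inv_ne_zero h2.ne'),
    Measure.prod_smul_left, Measure.prod_smul_right, smul_smul, inv_inv, inv_inv,
    abs_of_pos h1, abs_of_pos h2, ENNReal.ofReal_mul h1.le]

theorem quasiMeasurePreserving_dilation (hb₁ : 0 < A₁ 0 1) (hb₂ : 0 < A₂ 0 1) :
    Measure.QuasiMeasurePreserving (dilation A₁ A₂) volume volume :=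
  ⟨measurable_dilation, by
    rw [map_dilation hb₁ hb₂]; exact Measure.smul_absolutelyContinuous⟩

theorem outer_congr_ae (hb₁ : 0 < A₁ 0 1) (hb₂ : 0 < A₂ 0 1) {G G' : ℝ × ℝ → Quaternion ℝ}
    (h : G =ᵐ[volume] G') : outer A₁ A₂ G =ᵐ[volume] outer A₁ A₂ G' := by
  filter_upwards [(quasiMeasurePreserving_dilation hb₁ hb₂).ae_eq_comp h] with w hw
  simp only [Function.comp_apply] at hw
  rw [outer, outer, hw]

theorem aestronglyMeasurable_outer (hb₁ : 0 < A₁ 0 1) (hb₂ : 0 < A₂ 0 1)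
    {G : ℝ × ℝ → Quaternion ℝ} (hG : AEStronglyMeasurable G volume) :
    AEStronglyMeasurable (outer A₁ A₂ G) volume := by
  have c1 := continuous_outerFactor A₁
  have c2 := continuous_outerFactor A₂
  exact ((by fun_prop : Continuous fun w : ℝ × ℝ =>
    complexI (outerFactor A₁ w.1)).aestronglyMeasurable.mul
    (hG.comp_quasiMeasurePreserving (quasiMeasurePreserving_dilation hb₁ hb₂))).mul
    (by fun_prop : Continuous fun w : ℝ × ℝ =>
      complexJ (outerFactor A₂ w.2)).aestronglyMeasurable

/-- The outer factors have constant modulus with product m^(-1/2), which cancels the Jacobian m of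
the dilation. -/
theorem eLpNorm_outer (hb₁ : 0 < A₁ 0 1) (hb₂ : 0 < A₂ 0 1) {G : ℝ × ℝ → Quaternion ℝ}
    (hG : AEStronglyMeasurable G volume) :
    eLpNorm (outer A₁ A₂ G) 2 volume = eLpNorm G 2 volume := by
  have h1 : (0 : ℝ) < 2 * Real.pi * A₁ 0 1 := by positivity
  have h2 : (0 : ℝ) < 2 * Real.pi * A₂ 0 1 := by positivity
  set m := 2 * Real.pi * A₁ 0 1 * (2 * Real.pi * A₂ 0 1) with hm
  have hmp : 0 < m := mul_pos h1 h2
  have e1 : ∀ w, ‖outer A₁ A₂ G w‖ = ‖((√m)⁻¹ • (G ∘ dilation A₁ A₂)) w‖ := fun w => by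
    rw [outer, norm_mul, norm_mul, norm_complexI, norm_complexJ, norm_outerFactor hb₁,
      norm_outerFactor hb₂, Pi.smul_apply, norm_smul, hm, Real.sqrt_mul h1.le, mul_inv,
      Real.norm_of_nonneg (by positivity), Function.comp_apply]
    ring
  have hG' : AEStronglyMeasurable G (Measure.map (dilation A₁ A₂) volume) := by
    rw [map_dilation hb₁ hb₂]
    exact hG.smul_measure _
  rw [eLpNorm_congr_norm_ae (Eventually.of_forall e1), eLpNorm_const_smul,
    ← eLpNorm_map_measure hG' measurable_dilation.aemeasurable, map_dilation hb₁ hb₂,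
    eLpNorm_smul_measure_of_ne_zero (by simpa using hmp), smul_eq_mul, ← mul_assoc, ← hm]
  have e2 : ‖(√m)⁻¹‖ₑ * ENNReal.ofReal m ^ (1 / (2 : ENNReal)).toReal = 1 := by
    rw [Real.enorm_eq_ofReal (by positivity)]
    have : (1 / (2 : ENNReal)).toReal = 1 / 2 := by simp
    rw [this, ENNReal.ofReal_rpow_of_pos hmp, ← Real.sqrt_eq_rpow,
      ← ENNReal.ofReal_mul (by positivity), inv_mul_cancel₀ (Real.sqrt_pos.2 hmp).ne',
      ENNReal.ofReal_one]
  rw [e2, one_mul]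

theorem qlctIntegral_eq_outer (hb₁ : 0 < A₁ 0 1) (hb₂ : 0 < A₂ 0 1) {f : ℝ × ℝ → Quaternion ℝ}
    (hf : Integrable (chirped A₁ A₂ f)) :
    qlctIntegral A₁ A₂ f = outer A₁ A₂ (fourierIntegral (-1) (chirped A₁ A₂ f)) := by
  ext1 w
  have hi := integrable_phase_mul hf
    (a := fun z => -1 * (2 * Real.pi) * (z.1 * (dilation A₁ A₂ w).1))
    (b := fun z => -1 * (2 * Real.pi) * (z.2 * (dilation A₁ A₂ w).2)) (by fun_prop) (by fun_prop)
  rw [outer, fourierIntegral, ← integral_const_mul_of_integrable hi,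
    ← integral_mul_const_of_integrable (hi.const_mul _), qlctIntegral]
  congr 1
  ext1 z
  -- On the right of f the j-factors are reordered so that the chirp stands next to f and the outer
  -- factor comes last.
  rw [lctKernel_eq hb₁, lctKernel_eq hb₂, chirped_eq_phase, dilation,
    mul_comm (outerFactor A₂ w.2), mul_comm _ (phase (A₂ 0 0 / (2 * A₂ 0 1) * z.2 ^ 2))]
  simp only [complexI_mul, complexJ_mul, mul_assoc]

theorem norm_cutoff_sq {S : Set (ℝ × ℝ)} (hS : MeasurableSet S) (x : Signal) :
    ‖cutoff hS x‖ ^ 2 = ∫ z in S, ‖x z‖ ^ 2 := by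
  rw [norm_sq_eq_integral, ← integral_indicator hS]
  refine integral_congr_ae ?_
  filter_upwards [cutoff_ae hS x] with z hz
  rw [hz]
  by_cases h : z ∈ S <;> simp [h]

theorem aecover_square : AECover (volume : Measure (ℝ × ℝ)) atTop square where
  ae_eventually_mem := Eventually.of_forall fun z => by
    filter_upwards [eventually_ge_atTop (max |z.1| |z.2|)] with r hr
    exact mem_square_iff.2 ⟨(le_max_left _ _).trans hr, (le_max_right _ _).trans hr⟩
  measurableSet r := measurableSet_square r

/-- By Pythagoras the squared error is ‖x‖² minus the energy in the square, which exhausts ‖x‖². -/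
theorem tendsto_norm_sub_cutoff (x : Signal) :
    Tendsto (fun R : ℝ => ‖x - cutoff (measurableSet_square R) x‖) atTop (𝓝 0) := by
  have h1 := aecover_square.integral_tendsto_of_countably_generated
    ((Lp.memLp x).integrable_norm_pow two_ne_zero)
  simp_rw [← norm_cutoff_sq (measurableSet_square _) x] at h1
  have h2 : Tendsto (fun R : ℝ => √(‖x‖ ^ 2 - ‖cutoff (measurableSet_square R) x‖ ^ 2)) atTop
      (𝓝 (√(‖x‖ ^ 2 - ‖x‖ ^ 2))) := by
    refine (tendsto_const_nhds.sub ?_).sqrt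
    rw [norm_sq_eq_integral x]
    exact h1
  rw [sub_self, Real.sqrt_zero] at h2
  refine h2.congr fun R => ?_
  rw [← (isOrthProj_cutoff _).norm_sub_sq, Real.sqrt_sq (norm_nonneg _)]

theorem outer_sub (G G' : ℝ × ℝ → Quaternion ℝ) (w : ℝ × ℝ) :
    outer A₁ A₂ G w - outer A₁ A₂ G' w = outer A₁ A₂ (G - G') w := by
  simp only [outer, Pi.sub_apply, mul_sub, sub_mul]

variable (A₁ A₂) in
/-- The chirped version of a signal, as an element of `L²`. -/
def chirpedLp {f : ℝ × ℝ → Quaternion ℝ} (hf : MemLp f 2) : Signal :=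
  (memLp_chirped A₁ A₂ hf).toLp

theorem chirpedLp_ae {f : ℝ × ℝ → Quaternion ℝ} (hf : MemLp f 2) :
    (chirpedLp A₁ A₂ hf : ℝ × ℝ → Quaternion ℝ) =ᵐ[volume] chirped A₁ A₂ f :=
  MemLp.coeFn_toLp _

theorem qlctIntegral_indicator_ae (hb₁ : 0 < A₁ 0 1) (hb₂ : 0 < A₂ 0 1)
    {f : ℝ × ℝ → Quaternion ℝ} (hf : MemLp f 2) (R : ℝ) :
    qlctIntegral A₁ A₂ ((square R).indicator f) =ᵐ[volume]
      outer A₁ A₂ (qft (cutoff (measurableSet_square R) (chirpedLp A₁ A₂ hf))) := by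
  set x := chirpedLp A₁ A₂ hf
  have hc : (cutoff (measurableSet_square R) x : ℝ × ℝ → Quaternion ℝ) =ᵐ[volume]
      chirped A₁ A₂ ((square R).indicator f) := by
    rw [chirped_indicator]
    filter_upwards [cutoff_ae (measurableSet_square R) x, chirpedLp_ae (A₁ := A₁) (A₂ := A₂) hf]
      with z h1 h2
    rw [h1]
    by_cases hz : z ∈ square R <;> simp [hz, h2, x]
  have hi := integrable_cutoff (measurableSet_square R) (volume_square_ne_top R) x
  rw [qlctIntegral_eq_outer hb₁ hb₂ ((integrable_congr hc).1 hi)]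
  refine outer_congr_ae hb₁ hb₂ ((qft_ae_eq _ hi).trans ?_).symm
  refine Eventually.of_forall fun w => integral_congr_ae ?_
  filter_upwards [hc] with z hz
  rw [hz]

/-- The map from chirped signals to `outer` of their transforms is isometric, so the error at R
equals the energy norm of the discarded tail. -/
theorem isQLCT_outer (hb₁ : 0 < A₁ 0 1) (hb₂ : 0 < A₂ 0 1) {f : ℝ × ℝ → Quaternion ℝ}
    (hf : MemLp f 2) : IsQLCT A₁ A₂ f (outer A₁ A₂ (qft (chirpedLp A₁ A₂ hf))) := by
  set x := chirpedLp A₁ A₂ hf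
  refine ⟨⟨aestronglyMeasurable_outer hb₁ hb₂ (Lp.aestronglyMeasurable _), ?_⟩, ?_⟩
  · rw [eLpNorm_outer hb₁ hb₂ (Lp.aestronglyMeasurable _)]
    exact Lp.eLpNorm_lt_top _
  · have key : ∀ R : ℝ, eLpNorm (fun w => outer A₁ A₂ (qft x) w -
        qlctIntegral A₁ A₂ ((square R).indicator f) w) 2 volume =
        ENNReal.ofReal ‖x - cutoff (measurableSet_square R) x‖ := fun R => by
      have h1 : (fun w => outer A₁ A₂ (qft x) w -
          qlctIntegral A₁ A₂ ((square R).indicator f) w) =ᵐ[volume]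
          outer A₁ A₂ (qft (x - cutoff (measurableSet_square R) x)) := by
        rw [map_sub]
        have h2 := outer_congr_ae hb₁ hb₂
          (Lp.coeFn_sub (qft x) (qft (cutoff (measurableSet_square R) x)))
        filter_upwards [qlctIntegral_indicator_ae hb₁ hb₂ hf R, h2] with w h3 h4
        rw [h3, h4, outer_sub]
      rw [eLpNorm_congr_ae h1, eLpNorm_outer hb₁ hb₂ (Lp.aestronglyMeasurable _),
        ← LinearIsometryEquiv.norm_map qft, Lp.norm_def,
        ENNReal.ofReal_toReal (Lp.eLpNorm_ne_top _)]
    simp_rw [key]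
    have := (ENNReal.continuous_ofReal.tendsto 0).comp (tendsto_norm_sub_cutoff x)
    rwa [ENNReal.ofReal_zero] at this

/-- Limits in mean are unique; this identifies the representative picked by choice in `qlct`. -/
theorem IsQLCT.ae_eq {f F F' : ℝ × ℝ → Quaternion ℝ} (hF : IsQLCT A₁ A₂ f F)
    (hF' : IsQLCT A₁ A₂ f F')
    (hm : ∀ R, AEStronglyMeasurable (qlctIntegral A₁ A₂ ((square R).indicator f)) volume) :
    F =ᵐ[volume] F' := by
  have h1 : ∀ R, eLpNorm (F - F') 2 volume ≤
      eLpNorm (fun w => F w - qlctIntegral A₁ A₂ ((square R).indicator f) w) 2 volume +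
      eLpNorm (fun w => F' w - qlctIntegral A₁ A₂ ((square R).indicator f) w) 2 volume := by
    intro R
    have e : F - F' = (fun w => F w - qlctIntegral A₁ A₂ ((square R).indicator f) w) -
        (fun w => F' w - qlctIntegral A₁ A₂ ((square R).indicator f) w) := by
      ext1 w; simp
    rw [e]
    exact eLpNorm_sub_le (hF.1.1.sub (hm R)) (hF'.1.1.sub (hm R)) (by norm_num)
  have h2 : eLpNorm (F - F') 2 volume ≤ 0 := by
    have := hF.2.add hF'.2
    rw [add_zero] at this
    exact ge_of_tendsto' this h1
  have h3 := (eLpNorm_eq_zero_iff (hF.1.1.sub hF'.1.1) (by norm_num)).1 (le_antisymm h2 bot_le)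
  filter_upwards [h3] with w hw
  exact sub_eq_zero.1 hw

theorem qlct_ae_eq (hb₁ : 0 < A₁ 0 1) (hb₂ : 0 < A₂ 0 1) {f : ℝ × ℝ → Quaternion ℝ}
    (hf : MemLp f 2) :
    qlct A₁ A₂ f =ᵐ[volume] outer A₁ A₂ (qft (chirpedLp A₁ A₂ hf)) := by
  have hex : ∃ F, IsQLCT A₁ A₂ f F := ⟨_, isQLCT_outer hb₁ hb₂ hf⟩
  have h1 : IsQLCT A₁ A₂ f (qlct A₁ A₂ f) := by
    rw [qlct, dif_pos hex]; exact hex.choose_spec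
  refine h1.ae_eq (isQLCT_outer hb₁ hb₂ hf) fun R => ?_
  exact (aestronglyMeasurable_outer hb₁ hb₂ (Lp.aestronglyMeasurable _)).congr
    (qlctIntegral_indicator_ae hb₁ hb₂ hf R).symm

/-! ### Energies -/

theorem energy_congr_ae {f g : ℝ × ℝ → Quaternion ℝ} (h : f =ᵐ[volume] g) :
    energy f = energy g := by
  refine integral_congr_ae ?_
  filter_upwards [h] with z hz
  rw [hz]

theorem energy_coe (x : Signal) : energy x = ‖x‖ ^ 2 := (norm_sq_eq_integral x).symm

theorem energy_toLp {f : ℝ × ℝ → Quaternion ℝ} (hf : MemLp f 2) : energy f = ‖hf.toLp‖ ^ 2 := by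
  rw [← energy_coe, energy_congr_ae hf.coeFn_toLp]

theorem energy_eq_eLpNorm {f : ℝ × ℝ → Quaternion ℝ} (hf : MemLp f 2) :
    energy f = (eLpNorm f 2 volume).toReal ^ 2 := by
  rw [energy_toLp hf, Lp.norm_toLp]

theorem energy_outer (hb₁ : 0 < A₁ 0 1) (hb₂ : 0 < A₂ 0 1) (y : Signal) :
    energy (outer A₁ A₂ y) = ‖y‖ ^ 2 := by
  have h1 := eLpNorm_outer hb₁ hb₂ (Lp.aestronglyMeasurable y)
  rw [energy_eq_eLpNorm ⟨aestronglyMeasurable_outer hb₁ hb₂ (Lp.aestronglyMeasurable _), by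
    rw [h1]; exact Lp.eLpNorm_lt_top _⟩, h1, Lp.norm_def]

theorem energy_indicator_chirped (S : Set (ℝ × ℝ)) (f : ℝ × ℝ → Quaternion ℝ) :
    energy (S.indicator (chirped A₁ A₂ f)) = energy (S.indicator f) := by
  refine integral_congr_ae (Eventually.of_forall fun z => ?_)
  by_cases hz : z ∈ S <;> simp [hz, norm_chirped]

theorem energy_chirped (f : ℝ × ℝ → Quaternion ℝ) :
    energy (chirped A₁ A₂ f) = energy f := by
  refine integral_congr_ae (Eventually.of_forall fun z => ?_)
  simp [norm_chirped]

theorem energy_eq_chirpedLp {f : ℝ × ℝ → Quaternion ℝ} (hf : MemLp f 2) :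
    energy f = ‖chirpedLp A₁ A₂ hf‖ ^ 2 := by
  rw [← energy_coe, energy_congr_ae (chirpedLp_ae hf), energy_chirped]

theorem spatialRatio_eq {f : ℝ × ℝ → Quaternion ℝ} (hf : MemLp f 2) (τ : ℝ) :
    spatialRatio τ f = ‖cutoff (measurableSet_square τ) (chirpedLp A₁ A₂ hf)‖ ^ 2 /
      ‖chirpedLp A₁ A₂ hf‖ ^ 2 := by
  rw [spatialRatio, energy_eq_chirpedLp (A₁ := A₁) (A₂ := A₂) hf]
  congr 1
  rw [← energy_coe, ← energy_indicator_chirped (A₁ := A₁) (A₂ := A₂)]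
  refine energy_congr_ae ?_
  filter_upwards [cutoff_ae (measurableSet_square τ) (chirpedLp A₁ A₂ hf),
    chirpedLp_ae (A₁ := A₁) (A₂ := A₂) hf] with z h1 h2
  rw [h1]
  by_cases hz : z ∈ square τ <;> simp [hz, h2]

theorem dilation_mem_rect_iff (hb₁ : 0 < A₁ 0 1) (hb₂ : 0 < A₂ 0 1) {σ : ℝ} {w : ℝ × ℝ} :
    dilation A₁ A₂ w ∈ rect (σ / A₁ 0 1 / (2 * Real.pi)) (σ / A₂ 0 1 / (2 * Real.pi)) ↔
      w ∈ square σ := by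
  have key : ∀ b u : ℝ, 0 < b → ((2 * Real.pi * b)⁻¹ * u ∈
      Set.Icc (-(σ / b / (2 * Real.pi))) (σ / b / (2 * Real.pi)) ↔ u ∈ Set.Icc (-σ) σ) := by
    intro b u hb
    have hp : 0 < 2 * Real.pi * b := by positivity
    have e : σ / b / (2 * Real.pi) = (2 * Real.pi * b)⁻¹ * σ := by field_simp
    rw [e, Set.mem_Icc, Set.mem_Icc, ← mul_neg, mul_le_mul_iff_right₀ (inv_pos.2 hp),
      mul_le_mul_iff_right₀ (inv_pos.2 hp)]
  rw [rect, square, Set.mem_prod, Set.mem_prod]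
  exact and_congr (key _ _ hb₁) (key _ _ hb₂)

/-- The dilation matches the square of half-width σ with the rectangle of half-widths σ/(2πb₁) and
σ/(2πb₂), so the frequency cutoff commutes with `outer`, which preserves energy. -/
theorem frequencyRatio_eq (hb₁ : 0 < A₁ 0 1) (hb₂ : 0 < A₂ 0 1) {f : ℝ × ℝ → Quaternion ℝ}
    (hf : MemLp f 2) (σ : ℝ) :
    frequencyRatio A₁ A₂ σ f =
      ‖bandLimit (σ / A₁ 0 1 / (2 * Real.pi)) (σ / A₂ 0 1 / (2 * Real.pi))
        (chirpedLp A₁ A₂ hf)‖ ^ 2 / ‖chirpedLp A₁ A₂ hf‖ ^ 2 := by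
  have h1 := qlct_ae_eq hb₁ hb₂ hf
  set x := chirpedLp A₁ A₂ hf
  set R := rect (σ / A₁ 0 1 / (2 * Real.pi)) (σ / A₂ 0 1 / (2 * Real.pi)) with hR
  rw [frequencyRatio, energy_congr_ae h1, energy_outer hb₁ hb₂, LinearIsometryEquiv.norm_map,
    norm_bandLimit, ← energy_outer hb₁ hb₂ (cutoff _ (qft x))]
  congr 1
  refine energy_congr_ae ?_
  have h2 := outer_congr_ae hb₁ hb₂ (cutoff_ae (measurableSet_rect
    (σ / A₁ 0 1 / (2 * Real.pi)) (σ / A₂ 0 1 / (2 * Real.pi))) (qft x))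
  filter_upwards [h1, h2] with w h3 h4
  rw [h4]
  by_cases hw : w ∈ square σ
  · have := (dilation_mem_rect_iff hb₁ hb₂).2 hw
    rw [Set.indicator_of_mem hw, h3, outer, outer, Set.indicator_of_mem this]
  · have := (dilation_mem_rect_iff hb₁ hb₂).not.2 hw
    rw [Set.indicator_of_notMem hw, outer, Set.indicator_of_notMem this]
    simp

end Canonical

/-! ### The largest eigenvalue of the low-pass equation -/

section Eigenvalue

theorem IsOrthProj.apply_eq_self_of_norm_le {H : Type*} [NormedAddCommGroup H]
    [InnerProductSpace ℝ H] {D : H →L[ℝ] H} (hD : IsOrthProj D) {x : H} (h : ‖x‖ ≤ ‖D x‖) :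
    D x = x := by
  have h1 := hD.norm_sub_sq x
  have h2 : ‖x - D x‖ ^ 2 ≤ 0 := by
    rw [h1, sub_nonpos]; gcongr
  have h3 : ‖x - D x‖ = 0 := by
    nlinarith [norm_nonneg (x - D x), sq_nonneg ‖x - D x‖]
  exact (sub_eq_zero.1 (norm_eq_zero.1 h3)).symm

variable {τ ν₁ ν₂ : ℝ}

theorem norm_bandLimit_cutoff (x : Signal) :
    ‖bandLimit ν₁ ν₂ (cutoff (measurableSet_square τ) x)‖ =
      ‖limitedFourier (measurableSet_square τ) (measurableSet_rect ν₁ ν₂) x‖ := by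
  rw [norm_bandLimit, limitedFourier_apply]

/-- The indicator of the square is a witness: were its transform zero on the open rectangle, it
would itself be zero by `eq_zero_of_qft_eq_zero`. -/
theorem limitedFourier_ne_zero (hτ : 0 < τ) (h₁ : 0 < ν₁) (h₂ : 0 < ν₂) :
    limitedFourier (measurableSet_square τ) (measurableSet_rect ν₁ ν₂) ≠ 0 := by
  intro h
  have hS := measurableSet_square τ
  have hfin := volume_square_ne_top τ
  set f : Signal := indicatorConstLp 2 hS hfin 1
  have hf : cutoff hS f = f := by
    refine Lp.ext ?_
    filter_upwards [cutoff_ae hS f, indicatorConstLp_coeFn (p := 2) (hs := hS) (hμs := hfin)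
      (c := (1 : Quaternion ℝ))] with z h1 h2
    by_cases hz : z ∈ square τ
    · rw [h1, Set.indicator_of_mem hz]
    · rw [h1, Set.indicator_of_notMem hz, h2, Set.indicator_of_notMem hz]
  have hK : cutoff (measurableSet_rect ν₁ ν₂) (qft f) = 0 := by
    have : limitedFourier hS (measurableSet_rect ν₁ ν₂) f = 0 := by rw [h]; rfl
    rwa [limitedFourier_apply, hf] at this
  have h0 : f = 0 := by
    refine eq_zero_of_qft_eq_zero hf (O := Set.Ioo (-ν₁) ν₁ ×ˢ Set.Ioo (-ν₂) ν₂)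
      (isOpen_Ioo.prod isOpen_Ioo) ⟨(0, 0), by simp [h₁, h₂]⟩ ?_
    have h3 := cutoff_ae (measurableSet_rect ν₁ ν₂) (qft f)
    rw [hK] at h3
    filter_upwards [h3, Lp.coeFn_zero (Quaternion ℝ) 2 (volume : Measure (ℝ × ℝ))]
      with w h4 h5 h6
    have h7 : w ∈ rect ν₁ ν₂ :=
      Set.prod_mono Set.Ioo_subset_Icc_self Set.Ioo_subset_Icc_self h6
    rw [h5, Set.indicator_of_mem h7] at h4
    exact h4.symm
  have hn : ‖f‖ = 0 := by rw [h0, norm_zero]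
  rw [norm_indicatorConstLp (by norm_num) (by norm_num), norm_one, one_mul,
    Real.rpow_eq_zero measureReal_nonneg (by norm_num)] at hn
  have hv : volume (square τ) ≠ 0 := by
    rw [square, Measure.volume_eq_prod, Measure.prod_prod, Real.volume_Icc]
    simp [hτ]
  exact hv ((measureReal_eq_zero_iff hfin).1 hn)

/-- The largest energy concentration of time limited signals: it lies strictly between zero and
one, and is attained. -/
theorem exists_max_concentration (hτ : 0 < τ) (h₁ : 0 < ν₁) (h₂ : 0 < ν₂) :
    ∃ μ : ℝ, 0 < μ ∧ μ < 1 ∧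
      (∀ x, ‖bandLimit ν₁ ν₂ (cutoff (measurableSet_square τ) x)‖ ^ 2 ≤ μ * ‖x‖ ^ 2) ∧
      ∃ x, ‖x‖ = 1 ∧ ‖bandLimit ν₁ ν₂ (cutoff (measurableSet_square τ) x)‖ ^ 2 = μ := by
  set K := limitedFourier (measurableSet_square τ) (measurableSet_rect ν₁ ν₂) with hKdef
  have hS := measurableSet_square τ
  have hR := measurableSet_rect ν₁ ν₂
  have hK0 : K ≠ 0 := limitedFourier_ne_zero hτ h₁ h₂
  obtain ⟨x, hx, hKx⟩ := exists_norm_eq_opNorm K hK0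
    (tendsto_limitedFourier_of_weak _ _ (volume_square_ne_top τ) (volume_rect_ne_top ν₁ ν₂))
  have hpos : 0 < ‖K‖ := (norm_nonneg K).lt_of_ne fun h => hK0 (K.opNorm_zero_iff.1 h.symm)
  refine ⟨‖K‖ ^ 2, by positivity, ?_, fun y => ?_, x, hx, ?_⟩
  -- If ‖K‖ ≥ 1, neither cutoff loses energy of the maximizer, so it is limited in space and its
  -- transform is limited to the rectangle. The transform then vanishes on the open complement,
  -- forcing x = 0.
  · by_contra! hge
    have h1 : 1 ≤ ‖K x‖ := by rw [hKx]; nlinarith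
    rw [hKdef, limitedFourier_apply] at h1
    have h2 := (isOrthProj_cutoff hR).norm_apply_le (qft (cutoff hS x))
    rw [LinearIsometryEquiv.norm_map] at h2
    have hDx : cutoff hS x = x :=
      (isOrthProj_cutoff hS).apply_eq_self_of_norm_le (by rw [hx]; exact h1.trans h2)
    rw [hDx] at h1
    have hPx : cutoff hR (qft x) = qft x :=
      (isOrthProj_cutoff hR).apply_eq_self_of_norm_le (by
        rw [LinearIsometryEquiv.norm_map, hx]; exact h1)
    have hx0 : x = 0 := by
      refine eq_zero_of_qft_eq_zero hDx (O := (rect ν₁ ν₂)ᶜ)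
        (isClosed_Icc.prod isClosed_Icc).isOpen_compl ⟨(ν₁ + 1, 0), by simp [rect]⟩ ?_
      have h3 := cutoff_ae hR (qft x)
      rw [hPx] at h3
      filter_upwards [h3] with w h4 h5
      rw [h4, Set.indicator_of_notMem h5]
    rw [hx0, norm_zero] at hx
    exact zero_ne_one hx
  · rw [norm_bandLimit_cutoff, ← mul_pow]
    gcongr
    exact K.le_opNorm y
  · rw [norm_bandLimit_cutoff, hKx]

theorem two_pi_mul_div (ω : ℝ) : 2 * Real.pi * (ω / (2 * Real.pi)) = ω := by
  field_simp

variable {ω₁ ω₂ μ : ℝ}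

theorem bandLimit_cutoff_ae' (h₁ : 0 ≤ ω₁) (h₂ : 0 ≤ ω₂) (f : Signal) :
    (bandLimit (ω₁ / (2 * Real.pi)) (ω₂ / (2 * Real.pi)) (cutoff (measurableSet_square τ) f) :
      ℝ × ℝ → Quaternion ℝ) =ᵐ[volume] fun w => ∫ z in square τ,
        (lowPassKernel ω₁ (z.1 - w.1) * lowPassKernel ω₂ (z.2 - w.2)) • f z := by
  have := bandLimit_cutoff_ae (ν₁ := ω₁ / (2 * Real.pi)) (ν₂ := ω₂ / (2 * Real.pi))
    (by positivity) (by positivity) (measurableSet_square τ) (volume_square_ne_top τ) f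
  simpa only [two_pi_mul_div] using this

theorem IsLowPassEigenfunction.bandLimit_cutoff (h₁ : 0 ≤ ω₁) (h₂ : 0 ≤ ω₂)
    {ψ : ℝ × ℝ → Quaternion ℝ} (h : IsLowPassEigenfunction τ ω₁ ω₂ μ ψ) :
    h.1.toLp ≠ 0 ∧ bandLimit (ω₁ / (2 * Real.pi)) (ω₂ / (2 * Real.pi))
      (cutoff (measurableSet_square τ) h.1.toLp) = μ • h.1.toLp := by
  have hψ := h.1.coeFn_toLp
  refine ⟨fun h0 => h.2.1 ?_, Lp.ext ?_⟩
  · rw [h0] at hψ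
    exact hψ.symm.trans (Lp.coeFn_zero _ _ _)
  · filter_upwards [bandLimit_cutoff_ae' (τ := τ) h₁ h₂ h.1.toLp, hψ,
      Lp.coeFn_smul μ h.1.toLp] with w h3 h4 h5
    rw [h3, h5, Pi.smul_apply, h4, h.2.2 w]
    refine integral_congr_ae ?_
    filter_upwards [ae_restrict_of_ae hψ] with z hz
    rw [hz]

/-- The low-pass equation is required at every point, while g is only a class. The integral ignores
null sets, so dividing it by μ yields a representative that solves the equation everywhere. -/
theorem exists_isLowPassEigenfunction (h₁ : 0 ≤ ω₁) (h₂ : 0 ≤ ω₂) (hμ : μ ≠ 0) {g : Signal}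
    (hg : g ≠ 0) (h : bandLimit (ω₁ / (2 * Real.pi)) (ω₂ / (2 * Real.pi))
      (cutoff (measurableSet_square τ) g) = μ • g) :
    ∃ ψ, IsLowPassEigenfunction τ ω₁ ω₂ μ ψ ∧ ψ =ᵐ[volume] g := by
  let ψ : ℝ × ℝ → Quaternion ℝ := fun w => μ⁻¹ • ∫ z in square τ,
    (lowPassKernel ω₁ (z.1 - w.1) * lowPassKernel ω₂ (z.2 - w.2)) • g z
  have hψ : ψ =ᵐ[volume] g := by
    have h3 := bandLimit_cutoff_ae' (τ := τ) h₁ h₂ g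
    rw [h] at h3
    filter_upwards [h3, Lp.coeFn_smul μ g] with w h4 h5
    simp only [ψ]
    rw [← h4, h5, Pi.smul_apply, smul_smul, inv_mul_cancel₀ hμ, one_smul]
  refine ⟨ψ, ⟨(memLp_congr_ae hψ).2 (Lp.memLp g), fun h0 => hg ?_, fun w => ?_⟩, hψ⟩
  · rw [Lp.eq_zero_iff_ae_eq_zero]
    exact hψ.symm.trans h0
  · have h3 : μ • ψ w = ∫ z in square τ,
        (lowPassKernel ω₁ (z.1 - w.1) * lowPassKernel ω₂ (z.2 - w.2)) • g z :=
      smul_inv_smul₀ hμ _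
    rw [h3]
    refine integral_congr_ae ?_
    filter_upwards [ae_restrict_of_ae hψ] with z hz
    rw [hz]

theorem add_cutoff_ae (p q : ℝ) {g : Signal} {ψ : ℝ × ℝ → Quaternion ℝ} (h : ψ =ᵐ[volume] g) :
    ((p • g + q • cutoff (measurableSet_square τ) g : Signal) : ℝ × ℝ → Quaternion ℝ)
      =ᵐ[volume] fun z => p • ψ z + q • (square τ).indicator ψ z := by
  filter_upwards [h, Lp.coeFn_add (p • g) (q • cutoff (measurableSet_square τ) g),
    Lp.coeFn_smul p g, Lp.coeFn_smul q (cutoff (measurableSet_square τ) g),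
    cutoff_ae (measurableSet_square τ) g] with z h1 h2 h3 h4 h5
  rw [h2, Pi.add_apply, h3, h4, Pi.smul_apply, Pi.smul_apply, h5]
  by_cases hz : z ∈ square τ <;> simp [hz, h1]

end Eigenvalue

end QLCT

end

/-! ### The extremal problem for the canonical transform -/

theorem theorem5p2 (A₁ A₂ : Matrix (Fin 2) (Fin 2) ℝ) (hA₁ : A₁.det = 1) (hA₂ : A₂.det = 1)
    (hb₁ : 0 < A₁ 0 1) (hb₂ : 0 < A₂ 0 1) (τ σ : ℝ) (hτ : 0 < τ) (hσ : 0 < σ) :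
    ∃ μ₀ : ℝ,
      IsGreatest (QLCT.lowPassEigenvalues τ (σ / A₁ 0 1) (σ / A₂ 0 1)) μ₀ ∧ 0 < μ₀ ∧ μ₀ < 1 ∧
      ∀ α : ℝ, μ₀ < α → α ≤ 1 →
        ∃ βmax : ℝ,
          IsGreatest {β : ℝ | ∃ f : ℝ × ℝ → Quaternion ℝ, MemLp f 2 volume ∧
            QLCT.energy f ≠ 0 ∧ QLCT.spatialRatio τ f = α ∧
            QLCT.frequencyRatio A₁ A₂ σ f = β} βmax ∧
          Real.arccos (√βmax) + Real.arccos (√α) = Real.arccos (√μ₀) ∧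
          ∀ f : ℝ × ℝ → Quaternion ℝ, MemLp f 2 volume →
            ((QLCT.energy f = 1 ∧ QLCT.spatialRatio τ f = α ∧
                QLCT.frequencyRatio A₁ A₂ σ f = βmax) ↔
              ∃ ψ : ℝ × ℝ → Quaternion ℝ,
                QLCT.IsLowPassEigenfunction τ (σ / A₁ 0 1) (σ / A₂ 0 1) μ₀ ψ ∧
                QLCT.energy ψ = 1 ∧
                QLCT.chirped A₁ A₂ f =ᵐ[volume] fun z =>
                  √((1 - α) / (1 - μ₀)) • ψ z +
                    (√(α / μ₀) - √((1 - α) / (1 - μ₀))) •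
                      (QLCT.square τ).indicator ψ z) := by
  have hω₁ : 0 < σ / A₁ 0 1 := div_pos hσ hb₁
  have hω₂ : 0 < σ / A₂ 0 1 := div_pos hσ hb₂
  set B := QLCT.bandLimit (σ / A₁ 0 1 / (2 * Real.pi)) (σ / A₂ 0 1 / (2 * Real.pi)) with hBdef
  set D := QLCT.cutoff (QLCT.measurableSet_square τ) with hDdef
  have hB : QLCT.IsOrthProj B := QLCT.isOrthProj_bandLimit _ _
  have hD : QLCT.IsOrthProj D := QLCT.isOrthProj_cutoff _
  obtain ⟨μ, h0, hlt1, hμ, x₀, hx₀, hmax⟩ := QLCT.exists_max_concentration hτ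
    (ν₁ := σ / A₁ 0 1 / (2 * Real.pi)) (ν₂ := σ / A₂ 0 1 / (2 * Real.pi))
    (by positivity) (by positivity)
  obtain ⟨g₀, hg₀, he₀⟩ := hD.exists_eigen_of_max hB h0 hμ hx₀ hmax
  have hne : ∀ {g : QLCT.Signal}, ‖g‖ = 1 → g ≠ 0 := fun h h' => by simp [h'] at h
  refine ⟨μ, ⟨?_, ?_⟩, h0, hlt1, fun α hα hα1 => ?_⟩
  · obtain ⟨ψ, hψ, -⟩ := QLCT.exists_isLowPassEigenfunction hω₁.le hω₂.le h0.ne' (hne hg₀) he₀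
    exact ⟨ψ, hψ⟩
  · rintro ν ⟨ψ, hψ⟩
    obtain ⟨k1, k2⟩ := hψ.bandLimit_cutoff hω₁.le hω₂.le
    exact hD.eigenvalue_le hB h0 hμ k1 k2
  refine ⟨QLCT.cosGap μ α ^ 2, ⟨?_, ?_⟩, QLCT.arccos_cosGap h0 hα hα1, fun f hf => ?_⟩
  -- The maximum is attained by removing the chirps from the extremal vector built on the
  -- eigenvector g₀.
  · obtain ⟨f, hf, hfx⟩ := QLCT.exists_chirped_eq A₁ A₂
      (Lp.memLp (√((1 - α) / (1 - μ)) • g₀ + (√(α / μ) - √((1 - α) / (1 - μ))) • D g₀))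
    have hx : QLCT.chirpedLp A₁ A₂ hf =
        √((1 - α) / (1 - μ)) • g₀ + (√(α / μ) - √((1 - α) / (1 - μ))) • D g₀ :=
      Lp.ext ((QLCT.chirpedLp_ae hf).trans (by rw [hfx]))
    obtain ⟨k1, k2, k3⟩ := hD.extremal_of_eigen hB h0 hα hα1 hg₀ he₀ hx
    refine ⟨f, hf, ?_, ?_, ?_⟩
    · rw [QLCT.energy_eq_chirpedLp (A₁ := A₁) (A₂ := A₂) hf, k1]; norm_num
    · rw [QLCT.spatialRatio_eq (A₁ := A₁) (A₂ := A₂) hf, k1, k2]; norm_num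
    · rw [QLCT.frequencyRatio_eq hb₁ hb₂ hf, k1, k3]; norm_num
  · rintro β ⟨f, hf, hE, hsp, hfr⟩
    rw [QLCT.energy_eq_chirpedLp (A₁ := A₁) (A₂ := A₂) hf] at hE
    rw [QLCT.spatialRatio_eq (A₁ := A₁) (A₂ := A₂) hf] at hsp
    rw [QLCT.frequencyRatio_eq hb₁ hb₂ hf] at hfr
    set x := QLCT.chirpedLp A₁ A₂ hf
    have hxp : 0 < ‖x‖ := (norm_nonneg x).lt_of_ne fun h => hE (by rw [← h]; norm_num)
    -- The ratios are invariant under scaling, so the bound for unit vectors applies to x/‖x‖.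
    have key : ∀ T : QLCT.Signal →L[ℝ] QLCT.Signal,
        ‖T (‖x‖⁻¹ • x)‖ ^ 2 = ‖T x‖ ^ 2 / ‖x‖ ^ 2 := fun T => by
      rw [map_smul, norm_smul, norm_inv, norm_norm]; field_simp
    have hn : ‖(‖x‖⁻¹ • x : QLCT.Signal)‖ = 1 := by
      rw [norm_smul, norm_inv, norm_norm, inv_mul_cancel₀ hxp.ne']
    have := (hD.norm_sq_le_cosGap_sq hB h0 hμ hα hα1 hn ((key D).trans hsp)).1
    rwa [key B, hfr] at this
  · rw [QLCT.energy_eq_chirpedLp (A₁ := A₁) (A₂ := A₂) hf,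
      QLCT.spatialRatio_eq (A₁ := A₁) (A₂ := A₂) hf, QLCT.frequencyRatio_eq hb₁ hb₂ hf]
    have hae := QLCT.chirpedLp_ae (A₁ := A₁) (A₂ := A₂) hf
    set x := QLCT.chirpedLp A₁ A₂ hf
    constructor
    · rintro ⟨k1, k2, k3⟩
      rw [k1, div_one] at k2 k3
      have hx1 : ‖x‖ = 1 := by nlinarith [norm_nonneg x]
      obtain ⟨g, hg, he, hxg⟩ := (hD.norm_sq_le_cosGap_sq hB h0 hμ hα hα1 hx1 k2).2 k3
      obtain ⟨ψ, hψ, hψg⟩ :=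
        QLCT.exists_isLowPassEigenfunction hω₁.le hω₂.le h0.ne' (hne hg) he
      refine ⟨ψ, hψ, ?_, hae.symm.trans ?_⟩
      · rw [QLCT.energy_congr_ae hψg, QLCT.energy_coe, hg, one_pow]
      · rw [hxg]
        exact QLCT.add_cutoff_ae _ _ hψg
    · rintro ⟨ψ, hψ, hE, hfψ⟩
      obtain ⟨-, he⟩ := hψ.bandLimit_cutoff hω₁.le hω₂.le
      have hg : ‖hψ.1.toLp‖ = 1 := by
        rw [QLCT.energy_toLp hψ.1] at hE
        nlinarith [norm_nonneg hψ.1.toLp]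
      -- The almost everywhere formula becomes an identity in `L²`, to which `extremal_of_eigen`
      -- applies.
      have hxg := Lp.ext ((hae.trans hfψ).trans
        (QLCT.add_cutoff_ae (τ := τ) _ _ hψ.1.coeFn_toLp.symm).symm)
      obtain ⟨k1, k2, k3⟩ := hD.extremal_of_eigen hB h0 hα hα1 hg he hxg
      rw [k1, k2, k3]
      norm_num
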